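/- Let $F_3$ be the Brown--Thompson group: the group of all order-preserving homeomorphisms of $[0,1]$ that map the intervals of one triadic subdivision of $[0,1]$ affinely, in order, onto the intervals of another triadic subdivision with equally many intervals, with product $f\cdot g=g\circ f$. A triadic subdivision is given by the leaves of a finite rooted planar ternary tree: the root is $[0,1]$ and the three children of a vertex are the left, middle and right thirds of its interval. So $f\in F_3$ is given by pairs $(T_+,T_-)$ of ternary trees ($T_+$ for the domain, $T_-$ for the range) with equally many leaves, and by exactly one reduced pair, that is, a pair from which no caret (three sibling leaves of $T_+$ matched with three sibling leaves of $T_-$) can be removed. For a finite word $\alpha$ in $\{0,1,2\}$ let $I_\alpha\subseteq[0,1]$ be the triadic interval reached from $[0,1]$ by passing successively to the left ($0$), middle ($1$) or right ($2$) third, and let $\psi_\alpha\colon I_\alpha\to[0,1]$ be the increasing affine bijection. For $f\in F_3$ let $\varphi_\alpha(f)\in F_3$ be the identity outside $I_\alpha$ and $\psi_\alpha^{-1}f\psi_\alpha$ on $I_\alpha$. For $f\in F_3$ let $\mathcal L(f)$ be the isotopy class of the (unoriented) link in $\mathbb R^3$ obtained by Jones' algorithm: take the reduced pair $(T_+,T_-)$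 of $f$, draw $T_+$ above and $T_-$ upside down below a line so that their $k$-th leaves coincide for all $k$, replace every $4$-valent vertex by a crossing in which the strand joining the left and the right child passes over the strand joining the parent and the middle child (in both trees), and close the diagram by an arc that joins the two roots. (With "under" in place of "over", for all vertices, one obtains the mirror images; the statement holds for either convention.) For $f,g\in F_3$ put $\sqcup(f,g):=\varphi_1(f)\,\varphi_0(g)$. Then: 1. $\varphi_1(f)\,\varphi_0(g)=\varphi_0(g)\,\varphi_1(f)$ for all $f,g\in F_3$. 2. If $f\neq 1$ and $g\neq 1$, then $\mathcal L(\sqcup(f,g))$ is the disjoint union of $\mathcal L(f)$ and $\mathcal L(g)$, i.e. the isotopy class of the union of a link in $\mathcal L(f)$ and a link in $\mathcal L(g)$ that lie on different sides of a plane. 3. $\sqcup(f\cdot f',\,g\cdot g')=\sqcup(f,g)\cdot\sqcup(f',g')$ for all $f,f',g,g'\in F_3$. -/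

import Mathlib

/-! ### Ternary trees and addresses -/

/-- Finite rooted planar ternary trees: every vertex is a leaf or has exactly three ordered
children. -/
inductive TernaryTree : Type
  | leaf : TernaryTree
  | node (l m r : TernaryTree) : TernaryTree

namespace TernaryTree

def numLeaves : TernaryTree → ℕ
  | leaf => 1
  | node l m r => l.numLeaves + m.numLeaves + r.numLeaves

/-- The addresses of the leaves, from left to right. An address is the path from the root, with
`0` for left, `1` for straight on and `2` for right. -/
def leaves : TernaryTree → List (List (Fin 3))
  | leaf => [[]]
  | node l m r =>
      l.leaves.map (List.cons 0) ++ m.leaves.map (List.cons 1) ++ r.leaves.map (List.cons 2)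

/-- `AddCaret i T T'`: the tree `T'` arises from `T` by attaching a caret (a vertex with three
leaves) at the `i`-th leaf of `T`, leaves being counted from `0` from left to right. -/
inductive AddCaret : ℕ → TernaryTree → TernaryTree → Prop
  | here : AddCaret 0 leaf (node leaf leaf leaf)
  | left (i : ℕ) (l l' m r : TernaryTree) :
      AddCaret i l l' → AddCaret i (node l m r) (node l' m r)
  | mid (i : ℕ) (l m m' r : TernaryTree) :
      AddCaret i m m' → AddCaret (l.numLeaves + i) (node l m r) (node l m' r)
  | right (i : ℕ) (l m r r' : TernaryTree) :
      AddCaret i r r' → AddCaret (l.numLeaves + m.numLeaves + i) (node l m r) (node l m r')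

/-- A pair of trees is reduced if no caret can be removed from it, that is, if it does not arise
by attaching carets at the `i`-th leaves of both trees of another pair. -/
def Reduced (T S : TernaryTree) : Prop :=
  ¬ ∃ (i : ℕ) (T' S' : TernaryTree), AddCaret i T' T ∧ AddCaret i S' S

end TernaryTree

/-- The affine map of `[0,1]` onto its `i`-th third, for `i = 0, 1, 2`. -/
noncomputable def third (i : Fin 3) (s : unitInterval) : unitInterval :=
  ⟨(((i : ℕ) : ℝ) + s) / 3, by
    have h0 := s.2.1
    have h1 := s.2.2
    have h2 : (((i : ℕ) : ℝ)) ≤ 2 := by exact_mod_cast Nat.le_of_lt_succ i.2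
    have h3 : (0 : ℝ) ≤ ((i : ℕ) : ℝ) := Nat.cast_nonneg _
    constructor <;> linarith⟩

/-- The increasing affine map of `[0,1]` onto the triadic interval `I_α` of the address `α`.
It is the inverse of the linear isomorphism `ψ_α : I_α → [0,1]`. -/
noncomputable def place : List (Fin 3) → unitInterval → unitInterval
  | [], s => s
  | i :: α, s => third i (place α s)

/-- The order preserving homeomorphism `f` of `[0,1]` is represented by the pair of trees `(T, S)`:
the trees have the same number of leaves, and `f` maps the interval of the `k`-th leaf of `T`
affinely onto the interval of the `k`-th leaf of `S`, for all `k`. -/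
def Represents (f : unitInterval ≃o unitInterval) (T S : TernaryTree) : Prop :=
  List.Forall₂ (fun α β => ∀ s : unitInterval, f (place α s) = place β s) T.leaves S.leaves

/-! ### Facts on trees needed for the group structure -/

namespace TernaryTree

/-- `Grafts T ts T'`: the tree `T'` arises from `T` by attaching the trees of the list `ts` at the
leaves of `T`. -/
inductive Grafts : TernaryTree → List TernaryTree → TernaryTree → Prop
  | leaf (t : TernaryTree) : Grafts leaf [t] t
  | node (l m r l' m' r' : TernaryTree) (tl tm tr : List TernaryTree) :
      Grafts l tl l' → Grafts m tm m' → Grafts r tr r' →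
      Grafts (node l m r) (tl ++ tm ++ tr) (node l' m' r')

theorem length_leaves (T : TernaryTree) : T.leaves.length = T.numLeaves := by
  induction T with
  | leaf => rfl
  | node l m r hl hm hr => simp [leaves, numLeaves, hl, hm, hr, Nat.add_assoc]

theorem Grafts.length {T T' : TernaryTree} {ts : List TernaryTree} (h : Grafts T ts T') :
    ts.length = T.numLeaves := by
  induction h with
  | leaf t => rfl
  | node l m r l' m' r' tl tm tr _ _ _ h1 h2 h3 => simp [numLeaves, h1, h2, h3, Nat.add_assoc]

theorem exists_grafts (T : TernaryTree) :
    ∀ ts : List TernaryTree, ts.length = T.numLeaves → ∃ T', Grafts T ts T' := by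
  induction T with
  | leaf =>
    intro ts h
    obtain ⟨t, rfl⟩ := List.length_eq_one_iff.1 h
    exact ⟨t, Grafts.leaf t⟩
  | node l m r hl hm hr =>
    intro ts h
    simp only [numLeaves] at h
    obtain ⟨l', h1⟩ := hl (ts.take l.numLeaves) (by rw [List.length_take]; omega)
    obtain ⟨m', h2⟩ := hm ((ts.drop l.numLeaves).take m.numLeaves)
      (by rw [List.length_take, List.length_drop]; omega)
    obtain ⟨r', h3⟩ := hr ((ts.drop l.numLeaves).drop m.numLeaves)
      (by rw [List.length_drop, List.length_drop]; omega)
    refine ⟨TernaryTree.node l' m' r', ?_⟩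
    have h4 := Grafts.node _ _ _ _ _ _ _ _ _ h1 h2 h3
    rwa [List.append_assoc, List.take_append_drop, List.take_append_drop] at h4

theorem grafts_leaves (T : TernaryTree) : ∃ ts, Grafts T ts T := by
  induction T with
  | leaf => exact ⟨_, Grafts.leaf _⟩
  | node l m r hl hm hr =>
    obtain ⟨a, ha⟩ := hl
    obtain ⟨b, hb⟩ := hm
    obtain ⟨c, hc⟩ := hr
    exact ⟨_, Grafts.node _ _ _ _ _ _ _ _ _ ha hb hc⟩

/-- Two trees have a common refinement. -/
theorem exists_common (T : TernaryTree) :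
    ∀ S : TernaryTree, ∃ U ts ss, Grafts T ts U ∧ Grafts S ss U := by
  induction T with
  | leaf =>
    intro S
    obtain ⟨ss, hs⟩ := grafts_leaves S
    exact ⟨S, _, ss, Grafts.leaf S, hs⟩
  | node l m r hl hm hr =>
    intro S
    cases S with
    | leaf =>
      obtain ⟨ts, ht⟩ := grafts_leaves (TernaryTree.node l m r)
      exact ⟨_, ts, _, ht, Grafts.leaf _⟩
    | node l₂ m₂ r₂ =>
      obtain ⟨u, a, b, h1, h2⟩ := hl l₂
      obtain ⟨v, c, d, h3, h4⟩ := hm m₂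
      obtain ⟨w, e, k, h5, h6⟩ := hr r₂
      exact ⟨_, _, _, Grafts.node _ _ _ _ _ _ _ _ _ h1 h3 h5,
        Grafts.node _ _ _ _ _ _ _ _ _ h2 h4 h6⟩

theorem Grafts.leaves_eq {T T' : TernaryTree} {ts : List TernaryTree} (h : Grafts T ts T') :
    T'.leaves = (List.zipWith (fun α t => t.leaves.map (α ++ ·)) T.leaves ts).flatten := by
  induction h with
  | leaf t => simp [leaves]
  | node l m r l' m' r' tl tm tr g1 g2 g3 h1 h2 h3 =>
    have e1 := g1.length
    have e2 := g2.length
    simp only [leaves]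
    rw [List.zipWith_append (by simp [length_leaves, e1, e2]),
      List.zipWith_append (by simp [length_leaves, e1]), h1, h2, h3]
    simp [List.map_flatten, List.zipWith_map_left, List.map_zipWith, Function.comp_def]

theorem AddCaret.leaves_eq {i : ℕ} {T T' : TernaryTree} (h : AddCaret i T T') :
    ∃ A α B, A.length = i ∧ T.leaves = A ++ [α] ++ B ∧
      T'.leaves = A ++ [α ++ [0], α ++ [1], α ++ [2]] ++ B := by
  induction h with
  | here => exact ⟨[], [], [], rfl, rfl, rfl⟩
  | left i l l' m r _ ih =>
    obtain ⟨A, α, B, h1, h2, h3⟩ := ih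
    exact ⟨A.map (List.cons 0), 0 :: α,
      B.map (List.cons 0) ++ m.leaves.map (List.cons 1) ++ r.leaves.map (List.cons 2),
      by simp [h1], by simp [leaves, h2], by simp [leaves, h3]⟩
  | mid i l m m' r _ ih =>
    obtain ⟨A, α, B, h1, h2, h3⟩ := ih
    exact ⟨l.leaves.map (List.cons 0) ++ A.map (List.cons 1), 1 :: α,
      B.map (List.cons 1) ++ r.leaves.map (List.cons 2),
      by simp [h1, length_leaves], by simp [leaves, h2], by simp [leaves, h3]⟩
  | right i l m r r' _ ih =>
    obtain ⟨A, α, B, h1, h2, h3⟩ := ih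
    exact ⟨l.leaves.map (List.cons 0) ++ m.leaves.map (List.cons 1) ++ A.map (List.cons 2),
      2 :: α, B.map (List.cons 2),
      by simp [h1, length_leaves, Nat.add_assoc], by simp [leaves, h2], by simp [leaves, h3]⟩

end TernaryTree

/-! ### Facts on triadic intervals -/

theorem third_strictMono (i : Fin 3) : StrictMono (third i) := by
  intro s t h
  have h' : (s : ℝ) < t := h
  change (((i : ℕ) : ℝ) + s) / 3 < (((i : ℕ) : ℝ) + t) / 3
  linarith

theorem exists_third (t : unitInterval) : ∃ i s, third i s = t := by
  have h0 := t.2.1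
  have h1 := t.2.2
  rcases le_total (t : ℝ) (1 / 3) with h | h
  · refine ⟨0, ⟨3 * t, by linarith, by linarith⟩, Subtype.ext ?_⟩
    simp [third]
  · rcases le_total (t : ℝ) (2 / 3) with h' | h'
    · refine ⟨1, ⟨3 * t - 1, by linarith, by linarith⟩, Subtype.ext ?_⟩
      simp [third]
    · refine ⟨2, ⟨3 * t - 2, by linarith, by linarith⟩, Subtype.ext ?_⟩
      simp [third]

theorem exists_third_of_mem (i : Fin 3) (t : unitInterval)
    (h : t ∈ Set.Icc (third i 0) (third i 1)) : ∃ s, third i s = t := by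
  have h0 : (((i : ℕ) : ℝ) + 0) / 3 ≤ t := h.1
  have h1 : (t : ℝ) ≤ (((i : ℕ) : ℝ) + 1) / 3 := h.2
  refine ⟨⟨3 * t - ((i : ℕ) : ℝ), by linarith, by linarith⟩, Subtype.ext ?_⟩
  simp [third]

theorem place_strictMono (α : List (Fin 3)) : StrictMono (place α) := by
  induction α with
  | nil => exact strictMono_id
  | cons i α ih => exact (third_strictMono i).comp ih

theorem place_append (α β : List (Fin 3)) (s : unitInterval) :
    place (α ++ β) s = place α (place β s) := by
  induction α with
  | nil => rfl
  | cons i α ih => simp [place, ih]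

theorem exists_place_of_mem (α : List (Fin 3)) :
    ∀ t ∈ Set.Icc (place α 0) (place α 1), ∃ s, place α s = t := by
  induction α with
  | nil => exact fun t _ => ⟨t, rfl⟩
  | cons i α ih =>
    intro t ht
    obtain ⟨s, rfl⟩ := exists_third_of_mem i t
      ⟨((third_strictMono i).monotone (unitInterval.nonneg' (t := _))).trans ht.1,
        ht.2.trans ((third_strictMono i).monotone (unitInterval.le_one' (t := _)))⟩
    obtain ⟨s', rfl⟩ := ih s
      ⟨(third_strictMono i).le_iff_le.1 ht.1, (third_strictMono i).le_iff_le.1 ht.2⟩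
    exact ⟨s', rfl⟩

/-! ### Facts on representing pairs of trees -/

theorem represents_refl (T : TernaryTree) : Represents (OrderIso.refl _) T T :=
  List.forall₂_same.2 fun _ _ _ => rfl

theorem Represents.symm {f : unitInterval ≃o unitInterval} {T S : TernaryTree}
    (h : Represents f T S) : Represents f.symm S T := by
  refine (List.Forall₂.flip h).imp ?_
  intro α β h s
  rw [← h s, OrderIso.symm_apply_apply]

theorem forall₂_trans {A B C : List (List (Fin 3))} {f g : unitInterval ≃o unitInterval}
    (h1 : List.Forall₂ (fun α β => ∀ s, f (place α s) = place β s) A B)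
    (h2 : List.Forall₂ (fun α β => ∀ s, g (place α s) = place β s) B C) :
    List.Forall₂ (fun α β => ∀ s, (f.trans g) (place α s) = place β s) A C := by
  induction h1 generalizing C with
  | nil => cases h2; exact List.Forall₂.nil
  | cons h _ ih =>
    cases h2 with
    | cons h' h'' =>
      exact List.Forall₂.cons (fun s => by rw [OrderIso.trans_apply, h s, h' s]) (ih h'')

theorem forall₂_flatten {f : unitInterval ≃o unitInterval} {A B : List (List (Fin 3))}
    (h : List.Forall₂ (fun α β => ∀ s, f (place α s) = place β s) A B) :
    ∀ ts : List TernaryTree,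
    List.Forall₂ (fun α β => ∀ s, f (place α s) = place β s)
      (List.zipWith (fun α t => t.leaves.map (α ++ ·)) A ts).flatten
      (List.zipWith (fun α t => t.leaves.map (α ++ ·)) B ts).flatten := by
  induction h with
  | nil => simp
  | @cons α β A B h _ ih =>
    intro ts
    cases ts with
    | nil => simp
    | cons t ts =>
      simp only [List.zipWith_cons_cons, List.flatten_cons]
      refine List.rel_append ?_ (ih ts)
      rw [List.forall₂_map_left_iff, List.forall₂_map_right_iff]
      refine List.forall₂_same.2 fun γ _ s => ?_
      rw [place_append, place_append, h]

/-- A representing pair may be refined so that its second tree is a given refinement. -/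
theorem Represents.refine {f : unitInterval ≃o unitInterval} {T S U : TernaryTree}
    {ts : List TernaryTree} (h : Represents f T S) (hU : S.Grafts ts U) :
    ∃ T', Represents f T' U := by
  have hl : ts.length = T.numLeaves := by
    rw [hU.length, ← TernaryTree.length_leaves, ← TernaryTree.length_leaves]
    exact (List.Forall₂.length_eq h).symm
  obtain ⟨T', hT⟩ := TernaryTree.exists_grafts T ts hl
  refine ⟨T', ?_⟩
  unfold Represents
  rw [hT.leaves_eq, hU.leaves_eq]
  exact forall₂_flatten h ts

theorem Represents.trans {f g : unitInterval ≃o unitInterval} {T S S' U : TernaryTree}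
    (h : Represents f T S) (h' : Represents g S' U) :
    ∃ T' U', Represents (f.trans g) T' U' := by
  obtain ⟨V, ts, ss, h1, h2⟩ := TernaryTree.exists_common S S'
  obtain ⟨T', h3⟩ := h.refine h1
  obtain ⟨U', h4⟩ := h'.symm.refine h2
  exact ⟨T', U', forall₂_trans h3 h4.symm⟩

theorem Represents.removeCaret {f : unitInterval ≃o unitInterval} {i : ℕ}
    {T S T' S' : TernaryTree} (h : Represents f T S) (hT : TernaryTree.AddCaret i T' T)
    (hS : TernaryTree.AddCaret i S' S) :
    Represents f T' S' ∧ T'.leaves.length < T.leaves.length := by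
  obtain ⟨A, α, B, hA, h1, h2⟩ := hT.leaves_eq
  obtain ⟨A', β, B', hA', h3, h4⟩ := hS.leaves_eq
  unfold Represents at h ⊢
  rw [h2, h4, List.append_assoc, List.append_assoc] at h
  have e1 := List.forall₂_take A.length h
  have e2 := List.forall₂_drop A.length h
  have hAA : A.length = A'.length := hA.trans hA'.symm
  rw [List.take_left, hAA, List.take_left] at e1
  rw [List.drop_left, hAA, List.drop_left] at e2
  simp only [List.cons_append, List.nil_append, List.forall₂_cons] at e2
  obtain ⟨c0, c1, c2, e3⟩ := e2
  refine ⟨?_, by rw [h1, h2]; simp⟩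
  rw [h1, h3, List.append_assoc, List.append_assoc]
  refine List.rel_append e1 (List.Forall₂.cons ?_ e3)
  intro s
  obtain ⟨j, u, rfl⟩ := exists_third s
  fin_cases j
  · simpa [place_append, place] using c0 u
  · simpa [place_append, place] using c1 u
  · simpa [place_append, place] using c2 u

theorem exists_reduced (f : unitInterval ≃o unitInterval) :
    ∀ (n : ℕ) (T S : TernaryTree), T.leaves.length = n → Represents f T S →
      ∃ T' S', Represents f T' S' ∧ TernaryTree.Reduced T' S' := by
  intro n
  induction n using Nat.strong_induction_on with
  | _ n ih =>
    intro T S hn h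
    by_cases hr : TernaryTree.Reduced T S
    · exact ⟨T, S, h, hr⟩
    · obtain ⟨i, T', S', hT, hS⟩ := not_not.1 hr
      obtain ⟨h', hlt⟩ := h.removeCaret hT hS
      exact ih _ (hn ▸ hlt) T' S' rfl h'

/-! ### The Brown–Thompson group -/

/-- The Brown–Thompson group `F₃`: the order preserving homeomorphisms of `[0,1]` that map the
intervals of one triadic subdivision affinely onto those of another one. -/
@[ext]
structure F3 where
  toOrderIso : unitInterval ≃o unitInterval
  exists_represents : ∃ T S : TernaryTree, Represents toOrderIso T S

namespace F3

/-- Products are read from left to right: `f * g` is first `f`, then `g`. -/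
instance : Mul F3 where
  mul f g := ⟨f.toOrderIso.trans g.toOrderIso, by
    obtain ⟨T, S, h⟩ := f.exists_represents
    obtain ⟨S', U, h'⟩ := g.exists_represents
    exact h.trans h'⟩

instance : One F3 where
  one := ⟨OrderIso.refl _, TernaryTree.leaf, TernaryTree.leaf, represents_refl _⟩

instance : Inv F3 where
  inv f := ⟨f.toOrderIso.symm, by
    obtain ⟨T, S, h⟩ := f.exists_represents
    exact ⟨S, T, h.symm⟩⟩

instance : Group F3 :=
  Group.ofLeftAxioms (fun _ _ _ => rfl) (fun _ => rfl)
    (fun f => F3.ext (OrderIso.symm_trans_self f.toOrderIso))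

theorem exists_reducedPair (f : F3) :
    ∃ P : TernaryTree × TernaryTree,
      Represents f.toOrderIso P.1 P.2 ∧ TernaryTree.Reduced P.1 P.2 := by
  obtain ⟨T, S, h⟩ := f.exists_represents
  obtain ⟨T', S', h1, h2⟩ := exists_reduced f.toOrderIso _ T S rfl h
  exact ⟨(T', S'), h1, h2⟩

/-- The reduced pair of trees `(T₊, T₋)` of `f`. -/
noncomputable def reducedPair (f : F3) : TernaryTree × TernaryTree :=
  Classical.choose f.exists_reducedPair

/-! ### The maps `φ_α` and the operation `⊔` -/

/-- The map that is the identity outside `I_α` and is `ψ_α⁻¹ f ψ_α` on `I_α`. -/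
noncomputable def phiFun (α : List (Fin 3)) (f : unitInterval ≃o unitInterval) :
    unitInterval → unitInterval :=
  Function.extend (place α) (place α ∘ f) id

theorem phiFun_place (α : List (Fin 3)) (f : unitInterval ≃o unitInterval) (s : unitInterval) :
    phiFun α f (place α s) = place α (f s) :=
  (place_strictMono α).injective.extend_apply _ _ _

theorem phiFun_of_notMem (α : List (Fin 3)) (f : unitInterval ≃o unitInterval)
    {t : unitInterval} (h : ¬ ∃ s, place α s = t) : phiFun α f t = t :=
  Function.extend_apply' _ _ _ h

theorem phiFun_symm (α : List (Fin 3)) (f : unitInterval ≃o unitInterval) (t : unitInterval) :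
    phiFun α f.symm (phiFun α f t) = t := by
  by_cases h : ∃ s, place α s = t
  · obtain ⟨s, rfl⟩ := h
    rw [phiFun_place, phiFun_place, OrderIso.symm_apply_apply]
  · rw [phiFun_of_notMem α f h, phiFun_of_notMem α _ h]

theorem phiFun_monotone (α : List (Fin 3)) (f : unitInterval ≃o unitInterval) :
    Monotone (phiFun α f) := by
  have lo : ∀ s, place α 0 ≤ place α s := fun s =>
    (place_strictMono α).monotone unitInterval.nonneg'
  have hi : ∀ s, place α s ≤ place α 1 := fun s =>
    (place_strictMono α).monotone unitInterval.le_one'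
  intro x y hxy
  by_cases hx : ∃ s, place α s = x
  · obtain ⟨s, rfl⟩ := hx
    by_cases hy : ∃ u, place α u = y
    · obtain ⟨u, rfl⟩ := hy
      rw [phiFun_place, phiFun_place]
      exact (place_strictMono α).monotone
        (f.monotone ((place_strictMono α).le_iff_le.1 hxy))
    · rw [phiFun_place, phiFun_of_notMem α f hy]
      refine (hi _).trans (le_of_not_ge fun h => hy ?_)
      exact exists_place_of_mem α y ⟨(lo s).trans hxy, h⟩
  · rw [phiFun_of_notMem α f hx]
    by_cases hy : ∃ u, place α u = y
    · obtain ⟨u, rfl⟩ := hy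
      rw [phiFun_place]
      refine le_trans (le_of_not_ge fun h => hx ?_) (lo _)
      exact exists_place_of_mem α x ⟨h, hxy.trans (hi u)⟩
    · rwa [phiFun_of_notMem α f hy]

noncomputable def phiIso (α : List (Fin 3)) (f : unitInterval ≃o unitInterval) :
    unitInterval ≃o unitInterval where
  toFun := phiFun α f
  invFun := phiFun α f.symm
  left_inv := phiFun_symm α f
  right_inv t := by simpa using phiFun_symm α f.symm t
  map_rel_iff' := by
    intro x y
    refine ⟨fun h => ?_, fun h => phiFun_monotone α f h⟩
    have h' : phiFun α f.symm (phiFun α f x) ≤ phiFun α f.symm (phiFun α f y) :=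
      phiFun_monotone α f.symm h
    rwa [phiFun_symm, phiFun_symm] at h'

end F3

namespace TernaryTree

/-- The tree that consists of the path `α` with the tree `T` attached at its end. -/
def attachAt : List (Fin 3) → TernaryTree → TernaryTree
  | [], T => T
  | 0 :: α, T => node (attachAt α T) leaf leaf
  | 1 :: α, T => node leaf (attachAt α T) leaf
  | 2 :: α, T => node leaf leaf (attachAt α T)

/-- Apart from the leaves of `T`, the leaves of `attachAt α T` depend on `α` only and lie to the
left or to the right of `I_α`. -/
theorem leaves_attachAt (α : List (Fin 3)) :
    ∃ A B, (∀ T, (attachAt α T).leaves = A ++ T.leaves.map (α ++ ·) ++ B) ∧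
      (∀ β ∈ A, ∀ s, place β s ≤ place α 0) ∧ (∀ β ∈ B, ∀ s, place α 1 ≤ place β s) := by
  have key : ∀ (i j : Fin 3), i < j → ∀ s t, third i s ≤ third j t := by
    intro i j hij s t
    have h : ((i : ℕ) : ℝ) + 1 ≤ ((j : ℕ) : ℝ) := by exact_mod_cast hij
    have h1 := s.2.2
    have h2 := t.2.1
    change (((i : ℕ) : ℝ) + s) / 3 ≤ (((j : ℕ) : ℝ) + t) / 3
    linarith
  induction α with
  | nil => exact ⟨[], [], by simp [attachAt], by simp, by simp⟩
  | cons i α ih =>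
    obtain ⟨A, B, h, hA, hB⟩ := ih
    fin_cases i
    · refine ⟨A.map (List.cons 0), B.map (List.cons 0) ++ [[1], [2]],
        by simp [attachAt, leaves, h, Function.comp_def], ?_, ?_⟩
      · intro β hβ s
        obtain ⟨γ, hγ, rfl⟩ := List.mem_map.1 hβ
        exact (third_strictMono 0).monotone (hA γ hγ s)
      · intro β hβ s
        rcases List.mem_append.1 hβ with hβ | hβ
        · obtain ⟨γ, hγ, rfl⟩ := List.mem_map.1 hβ
          exact (third_strictMono 0).monotone (hB γ hγ s)
        · simp only [List.mem_cons, List.not_mem_nil, or_false] at hβ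
          rcases hβ with rfl | rfl
          · exact key 0 1 (by decide) _ _
          · exact key 0 2 (by decide) _ _
    · refine ⟨[0] :: A.map (List.cons 1), B.map (List.cons 1) ++ [[2]],
        by simp [attachAt, leaves, h, Function.comp_def], ?_, ?_⟩
      · intro β hβ s
        rcases List.mem_cons.1 hβ with rfl | hβ
        · exact key 0 1 (by decide) _ _
        · obtain ⟨γ, hγ, rfl⟩ := List.mem_map.1 hβ
          exact (third_strictMono 1).monotone (hA γ hγ s)
      · intro β hβ s
        rcases List.mem_append.1 hβ with hβ | hβ
        · obtain ⟨γ, hγ, rfl⟩ := List.mem_map.1 hβ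
          exact (third_strictMono 1).monotone (hB γ hγ s)
        · obtain rfl := List.mem_singleton.1 hβ
          exact key 1 2 (by decide) _ _
    · refine ⟨[0] :: [1] :: A.map (List.cons 2), B.map (List.cons 2),
        by simp [attachAt, leaves, h, Function.comp_def], ?_, ?_⟩
      · intro β hβ s
        simp only [List.mem_cons] at hβ
        rcases hβ with rfl | rfl | hβ
        · exact key 0 2 (by decide) _ _
        · exact key 1 2 (by decide) _ _
        · obtain ⟨γ, hγ, rfl⟩ := List.mem_map.1 hβ
          exact (third_strictMono 2).monotone (hA γ hγ s)
      · intro β hβ s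
        obtain ⟨γ, hγ, rfl⟩ := List.mem_map.1 hβ
        exact (third_strictMono 2).monotone (hB γ hγ s)

end TernaryTree

namespace F3

theorem phiFun_of_le (α : List (Fin 3)) (f : unitInterval ≃o unitInterval) {t : unitInterval}
    (h : t ≤ place α 0) : phiFun α f t = t := by
  by_cases ht : ∃ s, place α s = t
  · obtain ⟨s, rfl⟩ := ht
    obtain rfl : s = 0 := le_antisymm ((place_strictMono α).le_iff_le.1 h) unitInterval.nonneg'
    rw [phiFun_place]
    congr 1
    exact f.map_bot
  · exact phiFun_of_notMem α f ht

theorem phiFun_of_ge (α : List (Fin 3)) (f : unitInterval ≃o unitInterval) {t : unitInterval}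
    (h : place α 1 ≤ t) : phiFun α f t = t := by
  by_cases ht : ∃ s, place α s = t
  · obtain ⟨s, rfl⟩ := ht
    obtain rfl : s = 1 := le_antisymm unitInterval.le_one' ((place_strictMono α).le_iff_le.1 h)
    rw [phiFun_place]
    congr 1
    exact f.map_top
  · exact phiFun_of_notMem α f ht

theorem represents_phiIso (α : List (Fin 3)) {f : unitInterval ≃o unitInterval}
    {T S : TernaryTree} (h : Represents f T S) :
    ∃ T' S', Represents (phiIso α f) T' S' := by
  obtain ⟨A, B, h0, hA, hB⟩ := TernaryTree.leaves_attachAt α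
  refine ⟨TernaryTree.attachAt α T, TernaryTree.attachAt α S, ?_⟩
  unfold Represents
  rw [h0, h0]
  refine List.rel_append (List.rel_append ?_ ?_) ?_
  · exact List.forall₂_same.2 fun β hβ s => phiFun_of_le α f (hA β hβ s)
  · rw [List.forall₂_map_left_iff, List.forall₂_map_right_iff]
    refine List.Forall₂.imp ?_ h
    intro β γ hβ s
    rw [place_append, place_append, ← hβ s]
    exact phiFun_place α f _
  · exact List.forall₂_same.2 fun β hβ s => phiFun_of_ge α f (hB β hβ s)

/-- The map `φ_α : F₃ → F₃`. -/
noncomputable def phi (α : List (Fin 3)) (f : F3) : F3 :=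
  ⟨phiIso α f.toOrderIso, by
    obtain ⟨T, S, h⟩ := f.exists_represents
    exact represents_phiIso α h⟩

/-- The operation `⊔(f, g) = φ₁(f) φ₀(g)`. -/
noncomputable def sqcup (f g : F3) : F3 := phi [1] f * phi [0] g

end F3

/-! ### Isotopy classes in space and the disjoint union -/

/-- Euclidean space `ℝ³`; only its topology matters below. In pictures, the first two coordinates
are those of the plane of the diagram and the third one points towards the viewer. -/
abbrev Space : Type := ℝ × ℝ × ℝ

/-- An ambient isotopy of space, with compact support. -/
structure AmbientIsotopy where
  toHomeo : unitInterval → Space ≃ₜ Space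
  continuous' : Continuous fun q : unitInterval × Space => toHomeo q.1 q.2
  at_zero : ∀ p, toHomeo 0 p = p
  compactSupport : ∃ K : Set Space, IsCompact K ∧ ∀ t, ∀ p ∉ K, toHomeo t p = p

/-- Two subsets of space are isotopic if an ambient isotopy carries one to the other. -/
def Isotopic (A B : Set Space) : Prop :=
  ∃ H : AmbientIsotopy, H.toHomeo 1 '' A = B

namespace AmbientIsotopy

theorem continuous_symm (H : AmbientIsotopy) :
    Continuous fun q : unitInterval × Space => (H.toHomeo q.1).symm q.2 := by
  obtain ⟨K, hK, hs⟩ := H.compactSupport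
  let e : unitInterval × Space ≃ unitInterval × Space :=
    { toFun := fun q => (q.1, H.toHomeo q.1 q.2)
      invFun := fun q => (q.1, (H.toHomeo q.1).symm q.2)
      left_inv := fun q => by simp
      right_inv := fun q => by simp }
  have hc : Continuous e := continuous_fst.prodMk H.continuous'
  have hp : IsProperMap e := by
    refine isProperMap_iff_isCompact_preimage.2 ⟨hc, fun C hC => ?_⟩
    refine (hC.union (isCompact_univ.prod hK)).of_isClosed_subset (hC.isClosed.preimage hc) ?_
    rintro ⟨t, p⟩ h
    by_cases hp : p ∈ K
    · exact Or.inr ⟨trivial, hp⟩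
    · have h' : (t, H.toHomeo t p) ∈ C := h
      rw [hs t p hp] at h'
      exact Or.inl h'
  have hi : Continuous e.symm := by
    refine continuous_iff_isClosed.2 fun C hC => ?_
    rw [← e.image_eq_preimage_symm]
    exact hp.isClosedMap C hC
  exact continuous_snd.comp hi

/-- The inverse isotopy. -/
def symm (H : AmbientIsotopy) : AmbientIsotopy where
  toHomeo t := (H.toHomeo t).symm
  continuous' := H.continuous_symm
  at_zero p := by rw [Homeomorph.symm_apply_eq, H.at_zero]
  compactSupport := by
    obtain ⟨K, hK, hs⟩ := H.compactSupport
    exact ⟨K, hK, fun t p hp => by rw [Homeomorph.symm_apply_eq, hs t p hp]⟩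

/-- An ambient isotopy carried over to the image of an open embedding `E`, and extended by the
identity. -/
noncomputable def extendFun (H : AmbientIsotopy) (E : Space → Space) (t : unitInterval) :
    Space → Space :=
  Function.extend E (E ∘ H.toHomeo t) id

theorem extendFun_apply (H : AmbientIsotopy) {E : Space → Space}
    (hE : Topology.IsOpenEmbedding E) (t : unitInterval) (p : Space) :
    H.extendFun E t (E p) = E (H.toHomeo t p) :=
  hE.injective.extend_apply _ _ _

theorem extendFun_of_notMem (H : AmbientIsotopy) (E : Space → Space) (t : unitInterval)
    {p : Space} (hp : p ∉ Set.range E) : H.extendFun E t p = p :=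
  Function.extend_apply' _ _ _ hp

theorem extendFun_of_notMem_image (H : AmbientIsotopy) {E : Space → Space}
    (hE : Topology.IsOpenEmbedding E) {K : Set Space}
    (hs : ∀ t, ∀ p ∉ K, H.toHomeo t p = p) (t : unitInterval) {p : Space} (hp : p ∉ E '' K) :
    H.extendFun E t p = p := by
  by_cases h : p ∈ Set.range E
  · obtain ⟨q, rfl⟩ := h
    rw [H.extendFun_apply hE, hs t q fun hq => hp ⟨q, hq, rfl⟩]
  · exact H.extendFun_of_notMem E t h

theorem extendFun_symm (H : AmbientIsotopy) {E : Space → Space}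
    (hE : Topology.IsOpenEmbedding E) (t : unitInterval) (p : Space) :
    H.symm.extendFun E t (H.extendFun E t p) = p := by
  by_cases h : p ∈ Set.range E
  · obtain ⟨q, rfl⟩ := h
    rw [H.extendFun_apply hE, H.symm.extendFun_apply hE]
    exact congrArg E ((H.toHomeo t).symm_apply_apply q)
  · rw [H.extendFun_of_notMem E t h, H.symm.extendFun_of_notMem E t h]

theorem continuous_extendFun (H : AmbientIsotopy) {E : Space → Space}
    (hE : Topology.IsOpenEmbedding E) :
    Continuous fun q : unitInterval × Space => H.extendFun E q.1 q.2 := by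
  obtain ⟨K, hK, hs⟩ := H.compactSupport
  refine continuous_iff_continuousAt.2 ?_
  rintro ⟨t, p⟩
  by_cases h : p ∈ Set.range E
  · obtain ⟨q, rfl⟩ := h
    have hE' : Topology.IsOpenEmbedding (Prod.map (id : unitInterval → unitInterval) E) :=
      Topology.IsOpenEmbedding.id.prodMap hE
    refine (hE'.continuousAt_iff (x := (t, q))).1 (Continuous.continuousAt ?_)
    refine (hE.continuous.comp H.continuous').congr ?_
    rintro ⟨u, r⟩
    exact (H.extendFun_apply hE u r).symm
  · have hc : IsClosed (E '' K) := (hK.image hE.continuous).isClosed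
    have hp : p ∉ E '' K := fun hp => h (Set.image_subset_range E K hp)
    have hn : (Prod.snd : unitInterval × Space → Space) =ᶠ[nhds (t, p)]
        fun q : unitInterval × Space => H.extendFun E q.1 q.2 := by
      filter_upwards [(hc.isOpen_compl.preimage continuous_snd).mem_nhds hp] with q hq
      exact (H.extendFun_of_notMem_image hE hs q.1 hq).symm
    exact continuous_snd.continuousAt.congr hn

noncomputable def extend (H : AmbientIsotopy) {E : Space → Space}
    (hE : Topology.IsOpenEmbedding E) : AmbientIsotopy where
  toHomeo t :=
    { toFun := H.extendFun E t
      invFun := H.symm.extendFun E t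
      left_inv := H.extendFun_symm hE t
      right_inv := H.symm.extendFun_symm hE t
      continuous_toFun := (H.continuous_extendFun hE).comp (Continuous.prodMk_right t)
      continuous_invFun := (H.symm.continuous_extendFun hE).comp (Continuous.prodMk_right t) }
  continuous' := H.continuous_extendFun hE
  at_zero p := by
    change H.extendFun E 0 p = p
    by_cases h : p ∈ Set.range E
    · obtain ⟨q, rfl⟩ := h
      rw [H.extendFun_apply hE, H.at_zero]
    · exact H.extendFun_of_notMem E 0 h
  compactSupport := by
    obtain ⟨K, hK, hs⟩ := H.compactSupport
    exact ⟨E '' K, hK.image hE.continuous, fun t p hp => H.extendFun_of_notMem_image hE hs t hp⟩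

end AmbientIsotopy

namespace Isotopic

theorem refl (A : Set Space) : Isotopic A A :=
  ⟨{ toHomeo := fun _ => Homeomorph.refl _
     continuous' := continuous_snd
     at_zero := fun _ => rfl
     compactSupport := ⟨∅, isCompact_empty, fun _ _ _ => rfl⟩ }, Set.image_id A⟩

theorem symm {A B : Set Space} : Isotopic A B → Isotopic B A := by
  rintro ⟨H, rfl⟩
  refine ⟨H.symm, ?_⟩
  change (H.toHomeo 1).symm '' (H.toHomeo 1 '' A) = A
  rw [← Set.image_comp]
  simp

theorem trans {A B C : Set Space} : Isotopic A B → Isotopic B C → Isotopic A C := by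
  rintro ⟨H, rfl⟩ ⟨G, rfl⟩
  refine ⟨{ toHomeo := fun t => (H.toHomeo t).trans (G.toHomeo t)
            continuous' := G.continuous'.comp (continuous_fst.prodMk H.continuous')
            at_zero := fun p => by simp [H.at_zero, G.at_zero]
            compactSupport := ?_ }, ?_⟩
  · obtain ⟨K, hK, hs⟩ := H.compactSupport
    obtain ⟨L, hL, hs'⟩ := G.compactSupport
    refine ⟨K ∪ L, hK.union hL, fun t p hp => ?_⟩
    have h1 : p ∉ K := fun h => hp (Or.inl h)
    have h2 : p ∉ L := fun h => hp (Or.inr h)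
    simp [hs t p h1, hs' t p h2]
  · rw [← Set.image_comp]
    rfl

theorem union_right {A B C : Set Space} {E : Space → Space} (hE : Topology.IsOpenEmbedding E)
    (hC : Disjoint C (Set.range E)) : Isotopic A B → Isotopic (E '' A ∪ C) (E '' B ∪ C) := by
  rintro ⟨H, rfl⟩
  refine ⟨H.extend hE, ?_⟩
  rw [Set.image_union]
  congr 1
  · rw [← Set.image_comp, ← Set.image_comp]
    exact Set.image_congr fun p _ => H.extendFun_apply hE 1 p
  · refine (Set.image_congr fun p hp => ?_).trans (Set.image_id C)
    exact H.extendFun_of_notMem E 1 (Set.disjoint_left.1 hC hp)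

end Isotopic

instance isotopySetoid : Setoid (Set Space) where
  r := Isotopic
  iseqv := ⟨Isotopic.refl, Isotopic.symm, Isotopic.trans⟩

/-- Isotopy classes of subsets of space, among them the isotopy classes of (unoriented) links. -/
def IsotopyClass : Type := Quotient isotopySetoid

/-- An orientation preserving homeomorphism of space onto the half-space `x < 0`. -/
noncomputable def intoLeft (p : Space) : Space := (-Real.exp (-p.1), p.2)

/-- An orientation preserving homeomorphism of space onto the half-space `x > 0`. -/
noncomputable def intoRight (p : Space) : Space := (Real.exp p.1, p.2)

theorem isOpenEmbedding_intoRight : Topology.IsOpenEmbedding intoRight :=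
  Real.isOpenEmbedding_exp.prodMap Topology.IsOpenEmbedding.id

theorem isOpenEmbedding_intoLeft : Topology.IsOpenEmbedding intoLeft :=
  (((Homeomorph.neg ℝ).isOpenEmbedding.comp Real.isOpenEmbedding_exp).comp
    (Homeomorph.neg ℝ).isOpenEmbedding).prodMap Topology.IsOpenEmbedding.id

theorem disjoint_intoRight (A : Set Space) :
    Disjoint (intoRight '' A) (Set.range intoLeft) := by
  rw [Set.disjoint_left]
  rintro _ ⟨p, -, rfl⟩ ⟨q, h⟩
  have h1 : -Real.exp (-q.1) = Real.exp p.1 := congrArg Prod.fst h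
  have h2 := Real.exp_pos (-q.1)
  have h3 := Real.exp_pos p.1
  linarith

theorem disjoint_intoLeft (A : Set Space) :
    Disjoint (intoLeft '' A) (Set.range intoRight) := by
  rw [Set.disjoint_left]
  rintro _ ⟨p, -, rfl⟩ ⟨q, h⟩
  have h1 : Real.exp q.1 = -Real.exp (-p.1) := congrArg Prod.fst h
  have h2 := Real.exp_pos q.1
  have h3 := Real.exp_pos (-p.1)
  linarith

/-- The disjoint (split) union of isotopy classes: representatives of the two classes are placed
on different sides of a plane. -/
noncomputable def IsotopyClass.disjointUnion : IsotopyClass → IsotopyClass → IsotopyClass :=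
  Quotient.map₂ (fun A B => intoLeft '' A ∪ intoRight '' B) (by
    intro A A' hA B B' hB
    have h1 : Isotopic (intoLeft '' A ∪ intoRight '' B) (intoLeft '' A' ∪ intoRight '' B) :=
      Isotopic.union_right isOpenEmbedding_intoLeft (disjoint_intoRight B) hA
    have h2 : Isotopic (intoRight '' B ∪ intoLeft '' A') (intoRight '' B' ∪ intoLeft '' A') :=
      Isotopic.union_right isOpenEmbedding_intoRight (disjoint_intoLeft A') hB
    rw [Set.union_comm, Set.union_comm (intoRight '' B')] at h2
    exact h1.trans h2)

/-! ### Jones' algorithm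

The link is drawn with vertical strands, which lie in the plane `z = 0`, and horizontal strands,
which run in front of this plane or behind it. The `k`-th leaf lies on the line `y = 0` at `x = k`.
The upper tree is drawn above this line and the lower tree, upside down, below it. A vertex of a
tree becomes a crossing: its edges to the left and to the right child form the horizontal strand
together with its two ends, its edges to the parent and to the middle child the vertical one. -/

/-- The rule that turns a vertex into a crossing: the strand from the left to the right child
passes over, or under, the strand from the parent to the middle child. The same strand passes over
in the upper tree and in the (reflected) lower tree. The two rules yield mirror images of each
other. -/
inductive CrossingRule : Type
  | horizontalOver : CrossingRule
  | horizontalUnder : CrossingRule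

/-- The level `z` of the horizontal strands. -/
def CrossingRule.level : CrossingRule → ℝ
  | horizontalOver => 1
  | horizontalUnder => -1

/-- The vertical segment above the point `x` from `y = a` to `y = b`. -/
def column (x a b : ℝ) : Set Space :=
  {p | p.1 = x ∧ p.2.1 ∈ Set.Icc a b ∧ p.2.2 = 0}

/-- The horizontal segment on the line of height `y` from `x = a` to `x = b` on the level of the
crossing rule, together with the two segments that join its ends to the plane `z = 0`. -/
def bridge (c : CrossingRule) (y a b : ℝ) : Set Space :=
  {p | p.2.1 = y ∧ ((p.1 ∈ Set.Icc a b ∧ p.2.2 = c.level) ∨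
    ((p.1 = a ∨ p.1 = b) ∧ p.2.2 ∈ Set.uIcc 0 c.level))}

namespace TernaryTree

def height : TernaryTree → ℕ
  | leaf => 0
  | node l m r => max l.height (max m.height r.height) + 1

/-- The position of the root: a vertex is drawn above its middle child. -/
def rootColumn : TernaryTree → ℕ
  | leaf => 0
  | node l m _ => l.numLeaves + m.rootColumn

/-- The drawing of a tree above the line `y = 0` with vertices replaced by crossings. The first
leaf lies at `x = k`, the edge from the root upwards ends at height `y`, and every vertex lies at
the height of its subtree. -/
def draw (c : CrossingRule) : TernaryTree → ℕ → ℕ → Set Space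
  | leaf, k, y => column k 0 y
  | node l m r, k, y =>
      l.draw c k (node l m r).height ∪
      m.draw c (k + l.numLeaves) y ∪
      r.draw c (k + l.numLeaves + m.numLeaves) (node l m r).height ∪
      bridge c (node l m r).height ((k + l.rootColumn : ℕ) : ℝ)
        ((k + l.numLeaves + m.numLeaves + r.rootColumn : ℕ) : ℝ)

/-- The link of a pair of trees: the drawings of the upper tree and of the reflected lower tree,
and an arc to the right of the diagram that joins the two roots. -/
def link (c : CrossingRule) (T S : TernaryTree) : Set Space :=
  T.draw c 0 (T.height + 1) ∪
  (fun p : Space => (p.1, -p.2.1, p.2.2)) '' S.draw c 0 (S.height + 1) ∪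
  (bridge c (T.height + 1) T.rootColumn T.numLeaves ∪
    column T.numLeaves (-(S.height + 1)) (T.height + 1) ∪
    bridge c (-(S.height + 1)) S.rootColumn T.numLeaves)

end TernaryTree

/-- The isotopy class `𝓛(f)` of the link that Jones' algorithm assigns to `f`, through its reduced
pair of trees. -/
noncomputable def F3.jonesLink (c : CrossingRule) (f : F3) : IsotopyClass :=
  Quotient.mk isotopySetoid (f.reducedPair.1.link c f.reducedPair.2)

/-! ### The operation `⊔` on the thirds of the interval -/

/-! On thirds the group side is transparent: `phi [i] f` acts as `f` on the `i`-th third and fixes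
the other two pointwise. Compared third by third, every `phi [i]` is multiplicative and two of them
with different indices commute. This gives the two algebraic assertions.

For the links, let `(T, S)` and `(T', S')` be the reduced pairs of `f` and `g`. Then `(node T' T
leaf, node S' S leaf)` represents `sqcup f g` (`F3.represents_sqcup`). If `f ≠ 1` it is reduced,
since only the root caret could be removed besides carets of the two smaller pairs. Reduced pairs
are unique (`Represents.unique`), so this pair defines the link.

In its diagram the two right leaves join the root crossings. The horizontal strands of these
crossings therefore close up the diagram of `g`, while the vertical strands and the outer arc close
up that of `f` (`TernaryTree.link_node_leaf`). Where the two diagrams overlap in projection, `g`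
always lies on the same side of `f` (`TernaryTree.closedDiagram_above`). Hence `f` can be moved off
in depth, slid aside and brought back (`Isotopic.split`), and each of the two pieces is a planar
stretching of the link it came from (`TernaryTree.isotopic_closedDiagram`).

All isotopies come from one principle, `Isotopic.push`: a displacement along parallel lines that is
strictly increasing on each line moves a compact set by an ambient isotopy. -/

theorem third_le_third {i j : Fin 3} (hij : i < j) (s t : unitInterval) :
    third i s ≤ third j t := by
  have h : ((i : ℕ) : ℝ) + 1 ≤ ((j : ℕ) : ℝ) := by exact_mod_cast hij
  have h1 := s.2.2
  have h2 := t.2.1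
  change (((i : ℕ) : ℝ) + s) / 3 ≤ (((j : ℕ) : ℝ) + t) / 3
  linarith

namespace F3

theorem phi_apply_self (i : Fin 3) (f : F3) (s : unitInterval) :
    (phi [i] f).toOrderIso (third i s) = third i (f.toOrderIso s) :=
  phiFun_place [i] f.toOrderIso s

/-- Different thirds share at most an endpoint, and a conjugated increasing bijection fixes the
endpoints of its third. -/
theorem phi_apply_of_ne {i j : Fin 3} (h : i ≠ j) (f : F3) (s : unitInterval) :
    (phi [i] f).toOrderIso (third j s) = third j s := by
  rcases lt_or_gt_of_ne h with h | h
  · exact phiFun_of_ge [i] f.toOrderIso (third_le_third h _ _)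
  · exact phiFun_of_le [i] f.toOrderIso (third_le_third h _ _)

theorem mul_apply (f g : F3) (t : unitInterval) :
    (f * g).toOrderIso t = g.toOrderIso (f.toOrderIso t) := rfl

theorem ext_third {f g : F3}
    (h : ∀ i s, f.toOrderIso (third i s) = g.toOrderIso (third i s)) : f = g := by
  refine F3.ext (OrderIso.ext (funext fun t => ?_))
  obtain ⟨i, s, rfl⟩ := exists_third t
  exact h i s

theorem phi_mul (i : Fin 3) (f g : F3) : phi [i] (f * g) = phi [i] f * phi [i] g := by
  refine ext_third fun j s => ?_
  by_cases h : i = j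
  · subst h
    simp [mul_apply, phi_apply_self]
  · simp [mul_apply, phi_apply_of_ne h]

theorem phi_commute {i j : Fin 3} (h : i ≠ j) (f g : F3) :
    phi [i] f * phi [j] g = phi [j] g * phi [i] f := by
  refine ext_third fun k s => ?_
  by_cases hi : i = k
  · subst hi
    simp [mul_apply, phi_apply_self, phi_apply_of_ne h.symm]
  · by_cases hj : j = k
    · subst hj
      simp [mul_apply, phi_apply_self, phi_apply_of_ne hi]
    · simp [mul_apply, phi_apply_of_ne hi, phi_apply_of_ne hj]

theorem sqcup_mul (f f' g g' : F3) : sqcup (f * f') (g * g') = sqcup f g * sqcup f' g' := by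
  unfold sqcup
  -- Only the inner factors `phi [1] f'` and `phi [0] g` have to trade places.
  rw [phi_mul, phi_mul, mul_assoc, mul_assoc, ← mul_assoc (phi [1] f'),
    phi_commute (by decide), mul_assoc]

/-- `f` acts on the middle third and `g` on the left one, so their trees become middle and left
children; the right third is fixed and needs no subdivision. -/
theorem represents_sqcup {f g : F3} {T S T' S' : TernaryTree}
    (hf : Represents f.toOrderIso T S) (hg : Represents g.toOrderIso T' S') :
    Represents (sqcup f g).toOrderIso (.node T' T .leaf) (.node S' S .leaf) := by
  unfold Represents
  simp only [TernaryTree.leaves]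
  refine List.rel_append (List.rel_append ?_ ?_) ?_
  · rw [List.forall₂_map_left_iff, List.forall₂_map_right_iff]
    refine List.Forall₂.imp ?_ hg
    intro α β h s
    simp [place, sqcup, mul_apply, phi_apply_self, phi_apply_of_ne, h]
  · rw [List.forall₂_map_left_iff, List.forall₂_map_right_iff]
    refine List.Forall₂.imp ?_ hf
    intro α β h s
    simp [place, sqcup, mul_apply, phi_apply_self, phi_apply_of_ne, h]
  · refine List.Forall₂.cons ?_ List.Forall₂.nil
    intro s
    simp [place, sqcup, mul_apply, phi_apply_of_ne]

theorem eq_one_of_represents_leaf {f : F3}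
    (h : Represents f.toOrderIso .leaf .leaf) : f = 1 := by
  refine F3.ext (OrderIso.ext (funext fun t => ?_))
  simp only [Represents, TernaryTree.leaves, List.forall₂_cons] at h
  exact h.1 t

end F3

/-! ### Uniqueness of reduced pairs -/

/-- Interior points are required because neighbouring thirds share an endpoint. -/
theorem third_injective {i j : Fin 3} {s t : unitInterval} (hs : 0 < s) (hs' : s < 1)
    (ht : 0 < t) (ht' : t < 1) (h : third i s = third j t) : i = j := by
  have key : ∀ {i j : Fin 3} {s t : unitInterval}, s < 1 → 0 < t → third i s = third j t →
      ¬ i < j := by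
    intro i j s t hs ht h hij
    have h1 : third i s < third i 1 := third_strictMono i hs
    have h2 : third j 0 < third j t := third_strictMono j ht
    exact absurd (h1.trans_le ((third_le_third hij 1 0).trans h2.le)) (h ▸ lt_irrefl _)
  exact le_antisymm (not_lt.1 (key ht' hs h.symm)) (not_lt.1 (key hs' ht h))

/-- An interval inside a third is too short to contain both `0` and `1`. -/
theorem place_cons_ne_id (i : Fin 3) (α : List (Fin 3)) :
    ¬ ∀ s, s = place (i :: α) s := by
  intro h
  have h0 := congrArg Subtype.val (h 0)
  have h1 := congrArg Subtype.val (h 1)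
  have a0 := (place α 0).2.1
  have a1 := (place α 1).2.2
  simp only [place, third, Set.Icc.coe_zero, Set.Icc.coe_one] at h0 h1
  linarith

theorem address_ext : ∀ {α β : List (Fin 3)}, (∀ s, place α s = place β s) → α = β
  | [], [], _ => rfl
  | [], j :: β, h => absurd h (place_cons_ne_id j β)
  | i :: α, [], h => absurd (fun s => (h s).symm) (place_cons_ne_id i α)
  | i :: α, j :: β, h => by
    -- The midpoint lands in the interior of every triadic interval, so its image reveals the first
    -- letter of the address.
    let m : unitInterval := ⟨1 / 2, by norm_num, by norm_num⟩
    have m0 : 0 < m := Subtype.mk_lt_mk.2 (by norm_num)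
    have m1 : m < 1 := Subtype.mk_lt_mk.2 (by norm_num)
    have lo : ∀ γ, 0 < place γ m := fun γ =>
      unitInterval.nonneg'.trans_lt (place_strictMono γ m0)
    have hi : ∀ γ, place γ m < 1 := fun γ =>
      (place_strictMono γ m1).trans_le unitInterval.le_one'
    obtain rfl : i = j := third_injective (lo α) (hi α) (lo β) (hi β) (h m)
    rw [address_ext fun s => (third_strictMono i).injective (h s)]

namespace TernaryTree

theorem nodup_leaves (T : TernaryTree) : T.leaves.Nodup := by
  induction T with
  | leaf => simp [leaves]
  | node l m r hl hm hr =>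
    have inj : ∀ i : Fin 3, Function.Injective (List.cons i) := fun i => List.cons_injective
    simp only [leaves]
    refine List.Nodup.append (List.Nodup.append (hl.map (inj 0)) (hm.map (inj 1)) ?_)
      (hr.map (inj 2)) ?_
    all_goals
      intro x hx hx'
      simp only [List.mem_append, List.mem_map] at hx hx'
      grind

theorem nil_mem_leaves {T : TernaryTree} (h : [] ∈ T.leaves) : T = leaf := by
  cases T with
  | leaf => rfl
  | node l m r => simp [leaves] at h

theorem cons_mem_leaves_node {l m r : TernaryTree} {i : Fin 3} {α : List (Fin 3)} :
    i :: α ∈ (node l m r).leaves ↔ (i = 0 ∧ α ∈ l.leaves) ∨ (i = 1 ∧ α ∈ m.leaves) ∨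
      (i = 2 ∧ α ∈ r.leaves) := by
  simp only [leaves, List.mem_append, List.mem_map]
  grind

theorem exists_caret {T : TernaryTree} (h : T ≠ leaf) :
    ∃ δ : List (Fin 3), ∀ i, δ ++ [i] ∈ T.leaves := by
  induction T with
  | leaf => exact absurd rfl h
  | node l m r hl hm hr =>
    by_cases h1 : l = leaf
    · by_cases h2 : m = leaf
      · by_cases h3 : r = leaf
        · subst h1 h2 h3
          exact ⟨[], by decide⟩
        · obtain ⟨δ, hδ⟩ := hr h3
          exact ⟨2 :: δ, fun i => cons_mem_leaves_node.2 (by simp [hδ])⟩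
      · obtain ⟨δ, hδ⟩ := hm h2
        exact ⟨1 :: δ, fun i => cons_mem_leaves_node.2 (by simp [hδ])⟩
    · obtain ⟨δ, hδ⟩ := hl h1
      exact ⟨0 :: δ, fun i => cons_mem_leaves_node.2 (by simp [hδ])⟩

/-- `T` has a caret below a leaf of `S`. -/
def Exceeds (T S : TernaryTree) : Prop :=
  ∃ α ∈ S.leaves, ∃ δ : List (Fin 3), ∀ i, α ++ δ ++ [i] ∈ T.leaves

theorem Exceeds.cons {T S T' S' : TernaryTree} (i : Fin 3) (h : Exceeds T S)
    (hT : ∀ α ∈ T.leaves, i :: α ∈ T'.leaves) (hS : ∀ α ∈ S.leaves, i :: α ∈ S'.leaves) :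
    Exceeds T' S' := by
  obtain ⟨α, hα, δ, hδ⟩ := h
  exact ⟨i :: α, hS α hα, δ, fun j => hT _ (hδ j)⟩

theorem exceeds_leaf {T : TernaryTree} (h : T ≠ leaf) : Exceeds T leaf := by
  obtain ⟨δ, hδ⟩ := exists_caret h
  exact ⟨[], by simp [leaves], δ, hδ⟩

/-- Where two trees first differ, one ends in a leaf and the other goes on; the part that goes on
contains a caret. Uniqueness of reduced pairs thus amounts to excluding `Exceeds`. -/
theorem eq_or_exceeds (T : TernaryTree) : ∀ S, T = S ∨ Exceeds T S ∨ Exceeds S T := by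
  induction T with
  | leaf =>
    intro S
    by_cases h : S = leaf
    · exact Or.inl h.symm
    · exact Or.inr (Or.inr (exceeds_leaf h))
  | node l m r hl hm hr =>
    intro S
    cases S with
    | leaf => exact Or.inr (Or.inl (exceeds_leaf (by simp)))
    | node l' m' r' =>
      have c0 : ∀ {l m r : TernaryTree}, ∀ α ∈ l.leaves, 0 :: α ∈ (node l m r).leaves :=
        fun α h => cons_mem_leaves_node.2 (by simp [h])
      have c1 : ∀ {l m r : TernaryTree}, ∀ α ∈ m.leaves, 1 :: α ∈ (node l m r).leaves :=
        fun α h => cons_mem_leaves_node.2 (by simp [h])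
      have c2 : ∀ {l m r : TernaryTree}, ∀ α ∈ r.leaves, 2 :: α ∈ (node l m r).leaves :=
        fun α h => cons_mem_leaves_node.2 (by simp [h])
      rcases hl l' with rfl | h | h
      · rcases hm m' with rfl | h | h
        · rcases hr r' with rfl | h | h
          · exact Or.inl rfl
          · exact Or.inr (Or.inl (h.cons 2 c2 c2))
          · exact Or.inr (Or.inr (h.cons 2 c2 c2))
        · exact Or.inr (Or.inl (h.cons 1 c1 c1))
        · exact Or.inr (Or.inr (h.cons 1 c1 c1))
      · exact Or.inr (Or.inl (h.cons 0 c0 c0))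
      · exact Or.inr (Or.inr (h.cons 0 c0 c0))

/-- Links two descriptions of a caret: by addresses, which `f` transports, and by a leaf index,
which `Reduced` uses. The index is that of the left leaf of the caret, since the leaves before it
are unaffected by removing the caret. -/
theorem exists_addCaret (T : TernaryTree) : ∀ δ : List (Fin 3), (∀ i, δ ++ [i] ∈ T.leaves) →
    ∃ k T', AddCaret k T' T ∧ T.leaves[k]? = some (δ ++ [0]) := by
  induction T with
  | leaf =>
    intro δ h
    simpa [leaves] using h 0
  | node l m r hl hm hr =>
    intro δ h
    cases δ with
    | nil =>
      have h0 := h 0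
      have h1 := h 1
      have h2 := h 2
      simp only [List.nil_append, cons_mem_leaves_node] at h0 h1 h2
      obtain rfl := nil_mem_leaves (T := l) (by simpa using h0)
      obtain rfl := nil_mem_leaves (T := m) (by simpa using h1)
      obtain rfl := nil_mem_leaves (T := r) (by simpa using h2)
      exact ⟨0, leaf, AddCaret.here, rfl⟩
    | cons j δ =>
      simp only [List.cons_append, cons_mem_leaves_node] at h
      fin_cases j
      · obtain ⟨k, T', h1, h2⟩ := hl δ fun i => by simpa using h i
        have hk := (List.getElem?_eq_some_iff.1 h2).1
        refine ⟨k, _, AddCaret.left k T' l m r h1, ?_⟩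
        simp only [leaves]
        rw [List.append_assoc, List.getElem?_append_left (by simpa using hk)]
        simp [h2]
      · obtain ⟨k, T', h1, h2⟩ := hm δ fun i => by simpa using h i
        have hk := (List.getElem?_eq_some_iff.1 h2).1
        refine ⟨_, _, AddCaret.mid k l T' m r h1, ?_⟩
        simp only [leaves]
        rw [List.getElem?_append_left (by simpa [length_leaves] using hk),
          List.getElem?_append_right (by simp [length_leaves])]
        simp [h2, length_leaves]
      · obtain ⟨k, T', h1, h2⟩ := hr δ fun i => by simpa using h i
        refine ⟨_, _, AddCaret.right k l m T' r h1, ?_⟩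
        simp only [leaves]
        rw [List.getElem?_append_right (by simp [length_leaves])]
        simp [h2, length_leaves]

theorem leaves_prefix_free (T : TernaryTree) :
    ∀ α γ : List (Fin 3), α ∈ T.leaves → α ++ γ ∈ T.leaves → γ = [] := by
  induction T with
  | leaf =>
    intro α γ h1 h2
    simp only [leaves, List.mem_singleton, List.append_eq_nil_iff] at h2
    exact h2.2
  | node l m r hl hm hr =>
    intro α γ h1 h2
    cases α with
    | nil => simp [leaves] at h1
    | cons i α =>
      rw [List.cons_append] at h2
      rw [cons_mem_leaves_node] at h1 h2
      grind

/-- If one of two different trees with the same leaves exceeded the other, a leaf address would be a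
proper prefix of another. -/
theorem leaves_injective : Function.Injective leaves := by
  have key : ∀ {T S : TernaryTree}, T.leaves = S.leaves → ¬ Exceeds T S := by
    rintro T S h ⟨α, hα, δ, hδ⟩
    have h0 := hδ 0
    rw [h, List.append_assoc] at h0
    simpa using S.leaves_prefix_free _ _ hα h0
  intro T S h
  rcases eq_or_exceeds T S with h' | h' | h'
  · exact h'
  · exact absurd h' (key h)
  · exact absurd h' (key h.symm)

theorem eq_leaf_of_numLeaves {T : TernaryTree} (h : T.numLeaves = 1) : T = leaf := by
  have pos : ∀ S : TernaryTree, 0 < S.numLeaves := by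
    intro S
    induction S with
    | leaf => exact Nat.one_pos
    | node l m r hl hm hr => simp only [numLeaves]; omega
  cases T with
  | leaf => rfl
  | node l m r =>
    have h1 := pos l
    have h2 := pos m
    have h3 := pos r
    simp only [numLeaves] at h
    omega

theorem AddCaret.lt {i : ℕ} {T T' : TernaryTree} (h : AddCaret i T T') : i < T'.numLeaves := by
  induction h with
  | here => decide
  | left i l l' m r _ ih => simp only [numLeaves]; omega
  | mid i l m m' r _ ih => simp only [numLeaves]; omega
  | right i l m r r' _ ih => simp only [numLeaves]; omega

/-- A removable caret lies in the left subtree, in the middle one, or at the root. Equal leaf counts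
force its index into the same subtree of both trees, so the first two cases contradict reducedness
of the smaller pairs. The root caret would make both `B` and `B'` leaves. -/
theorem Reduced.node_leaf {A A' B B' : TernaryTree} (hA : Reduced A A') (hB : Reduced B B')
    (nA : A.numLeaves = A'.numLeaves) (hne : ¬ (B = leaf ∧ B' = leaf))
    (nB : B.numLeaves = B'.numLeaves) :
    Reduced (node A B leaf) (node A' B' leaf) := by
  rintro ⟨i, U, V, hU, hV⟩
  cases hU with
  | here => exact hne ⟨rfl, eq_leaf_of_numLeaves nB.symm⟩
  | left _ l _ _ _ h =>
    have hlt := h.lt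
    generalize hi : i = i' at hV
    cases hV with
    | here => exact hne ⟨eq_leaf_of_numLeaves nB, rfl⟩
    | left _ l' _ _ _ h' => exact hA ⟨i, _, _, h, hi ▸ h'⟩
    | mid j => omega
    | right _ _ _ _ _ h' => cases h'
  | mid j _ m _ _ h =>
    generalize hi : A.numLeaves + j = i at hV
    cases hV with
    | here => exact hne ⟨eq_leaf_of_numLeaves nB, rfl⟩
    | left _ _ _ _ _ h' =>
      have hlt := h'.lt
      omega
    | mid j' _ _ _ _ h' =>
      obtain rfl : j = j' := by omega
      exact hB ⟨j, _, _, h, h'⟩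
    | right _ _ _ _ _ h' => cases h'
  | right _ _ _ _ _ h => cases h

end TernaryTree

theorem Represents.numLeaves_eq {f : unitInterval ≃o unitInterval} {T S : TernaryTree}
    (h : Represents f T S) : T.numLeaves = S.numLeaves := by
  rw [← TernaryTree.length_leaves, ← TernaryTree.length_leaves]
  exact List.Forall₂.length_eq h

theorem Represents.getElem? {f : unitInterval ≃o unitInterval} {T S : TernaryTree}
    (h : Represents f T S) {k : ℕ} {α β : List (Fin 3)} (hα : T.leaves[k]? = some α)
    (hf : ∀ s, f (place α s) = place β s) : S.leaves[k]? = some β := by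
  obtain ⟨hk, rfl⟩ := List.getElem?_eq_some_iff.1 hα
  have hk' : k < S.leaves.length := by rwa [← List.Forall₂.length_eq h]
  rw [List.getElem?_eq_getElem hk']
  refine congrArg some (address_ext fun s => ?_)
  rw [← hf]
  exact ((List.forall₂_iff_get.1 h).2 k hk hk' s).symm

/-- On the interval of the leaf `α` of `T₁` the map `f` is affine, onto some `I_β`. It therefore
carries the caret of `T` at `α ++ δ` to leaves of `S` that form a caret at `β ++ δ`, matched index
by index, and this common caret could be removed. -/
theorem Represents.not_exceeds {f : unitInterval ≃o unitInterval} {T S T₁ S₁ : TernaryTree}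
    (h : Represents f T S) (hr : T.Reduced S) (h₁ : Represents f T₁ S₁) : ¬ T.Exceeds T₁ := by
  rintro ⟨α, hα, δ, hδ⟩
  obtain ⟨β, hβ⟩ : ∃ β, ∀ s, f (place α s) = place β s := by
    obtain ⟨k, hk, rfl⟩ := List.getElem_of_mem hα
    have hk' : k < S₁.leaves.length := by rwa [← List.Forall₂.length_eq h₁]
    exact ⟨_, (List.forall₂_iff_get.1 h₁).2 k hk hk'⟩
  have hf : ∀ i s, f (place (α ++ δ ++ [i]) s) = place (β ++ δ ++ [i]) s := by
    intro i s
    rw [List.append_assoc, List.append_assoc, place_append, hβ, ← place_append]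
  have hS : ∀ i, β ++ δ ++ [i] ∈ S.leaves := by
    intro i
    obtain ⟨k, hk⟩ := List.mem_iff_getElem?.1 (hδ i)
    exact List.mem_iff_getElem?.2 ⟨k, h.getElem? hk (hf i)⟩
  obtain ⟨k, T', hT', hk⟩ := T.exists_addCaret _ hδ
  obtain ⟨k', S', hS', hk'⟩ := S.exists_addCaret _ hS
  have hk'' := h.getElem? hk (hf 0)
  obtain rfl : k = k' := by
    obtain ⟨l1, e1⟩ := List.getElem?_eq_some_iff.1 hk''
    obtain ⟨l2, e2⟩ := List.getElem?_eq_some_iff.1 hk'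
    exact (S.nodup_leaves.getElem_inj_iff).1 (e1.trans e2.symm)
  exact hr ⟨k, T', S', hT', hS'⟩

/-- An element of `F₃` is represented by at most one reduced pair. -/
theorem Represents.unique {f : unitInterval ≃o unitInterval} {T S T₁ S₁ : TernaryTree}
    (h : Represents f T S) (hr : T.Reduced S) (h₁ : Represents f T₁ S₁) (hr₁ : T₁.Reduced S₁) :
    T = T₁ ∧ S = S₁ := by
  obtain rfl : T = T₁ := by
    rcases T.eq_or_exceeds T₁ with e | e | e
    · exact e
    · exact absurd e (h.not_exceeds hr h₁)
    · exact absurd e (h₁.not_exceeds hr₁ h)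
  refine ⟨rfl, TernaryTree.leaves_injective ?_⟩
  refine List.ext_getElem? fun k => ?_
  by_cases hk : k < T.leaves.length
  · have hk' : k < S₁.leaves.length := by rwa [← List.Forall₂.length_eq h₁]
    rw [List.getElem?_eq_getElem hk']
    exact h.getElem? (List.getElem?_eq_getElem hk) ((List.forall₂_iff_get.1 h₁).2 k hk hk')
  · rw [List.getElem?_eq_none (by rw [← List.Forall₂.length_eq h]; omega),
      List.getElem?_eq_none (by rw [← List.Forall₂.length_eq h₁]; omega)]

theorem F3.reducedPair_spec (f : F3) :
    Represents f.toOrderIso f.reducedPair.1 f.reducedPair.2 ∧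
      TernaryTree.Reduced f.reducedPair.1 f.reducedPair.2 :=
  Classical.choose_spec f.exists_reducedPair

theorem F3.reducedPair_sqcup {f : F3} (g : F3) (hf : f ≠ 1) :
    (sqcup f g).reducedPair = (.node g.reducedPair.1 f.reducedPair.1 .leaf,
      .node g.reducedPair.2 f.reducedPair.2 .leaf) := by
  obtain ⟨f1, f2⟩ := f.reducedPair_spec
  obtain ⟨g1, g2⟩ := g.reducedPair_spec
  obtain ⟨h1, h2⟩ := (sqcup f g).reducedPair_spec
  have hr := g2.node_leaf f2 g1.numLeaves_eq (fun h => hf (eq_one_of_represents_leaf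
    (by rwa [h.1, h.2] at f1))) f1.numLeaves_eq
  exact Prod.ext_iff.2 (h1.unique h2 (represents_sqcup f1 g1) hr)

/-! ### Pushing along a direction -/

section Push

variable {e : Space} {w : Space → ℝ}

/-- The function is the convex combination with weights `1 - t` and `t` of `s` and `s + w`. -/
theorem strictMono_push (hm : ∀ p, StrictMono fun s : ℝ => s + w (p + s • e))
    {t : ℝ} (h0 : 0 ≤ t) (h1 : t ≤ 1) (p : Space) :
    StrictMono fun s : ℝ => s + t * w (p + s • e) := by
  intro a b hab
  have h := hm p hab
  simp only at h ⊢
  rcases h0.eq_or_lt with rfl | h0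
  · simpa using hab
  · nlinarith [mul_lt_mul_of_pos_left h h0, mul_nonneg (sub_nonneg.2 h1) (sub_nonneg.2 hab.le)]

theorem push_injective (hm : ∀ p, StrictMono fun s : ℝ => s + w (p + s • e))
    {t : ℝ} (h0 : 0 ≤ t) (h1 : t ≤ 1) : Function.Injective fun p => p + (t * w p) • e := by
  intro p q h
  have hq : q = p + (t * w p - t * w q) • e := by
    rw [sub_smul, ← add_sub_assoc]
    exact eq_sub_of_add_eq h.symm
  -- `p` and `q` lie on one line of direction `e`, and the increasing function of `strictMono_push`
  -- takes the same value at their two parameters.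
  have hs : t * w p - t * w q = 0 := by
    refine (strictMono_push hm h0 h1 p).injective ?_
    simp only [← hq, zero_smul, add_zero]
    ring
  rw [hq, hs, zero_smul, add_zero]

theorem push_surjective (hw : Continuous w) {C : ℝ} (hC : ∀ p, |w p| ≤ C)
    {t : ℝ} (h0 : 0 ≤ t) (h1 : t ≤ 1) : Function.Surjective fun p => p + (t * w p) • e := by
  intro q
  have hb : ∀ p, |t * w p| ≤ C := fun p => by
    rw [abs_mul, abs_of_nonneg h0]
    nlinarith [hC p, abs_nonneg (w p)]
  have hc : Continuous fun s : ℝ => s + t * w (q + s • e) := by fun_prop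
  have hC0 : 0 ≤ C := (abs_nonneg _).trans (hC 0)
  obtain ⟨s, -, hs⟩ := intermediate_value_Icc (f := fun s : ℝ => s + t * w (q + s • e))
    (by linarith : -C ≤ C) hc.continuousOn (show (0 : ℝ) ∈ Set.Icc _ _ from
      ⟨by have := (abs_le.1 (hb (q + (-C) • e))).2; linarith,
        by have := (abs_le.1 (hb (q + C • e))).1; linarith⟩)
  refine ⟨q + s • e, ?_⟩
  simp only at hs ⊢
  rw [add_assoc, ← add_smul, hs, zero_smul, add_zero]

/-- The map is the identity outside a ball, hence proper. Closedness is what makes the inverse of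
the bijection continuous. -/
theorem isClosedMap_push (hw : Continuous w) {R : ℝ} (hR : ∀ p, R ≤ ‖p‖ → w p = 0) (t : ℝ) :
    IsClosedMap fun p => p + (t * w p) • e := by
  have hc : Continuous fun p => p + (t * w p) • e := by fun_prop
  refine IsProperMap.isClosedMap (isProperMap_iff_isCompact_preimage.2 ⟨hc, fun C hC => ?_⟩)
  refine (hC.union (isCompact_closedBall (0 : Space) R)).of_isClosed_subset
    (hC.isClosed.preimage hc) fun p hp => ?_
  rcases le_total R ‖p‖ with h | h
  · left
    simpa [hR p h] using hp
  · right
    simpa using h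

theorem AmbientIsotopy.exists_push (hw : Continuous w) {R C : ℝ} (hR : ∀ p, R ≤ ‖p‖ → w p = 0)
    (hC : ∀ p, |w p| ≤ C) (hm : ∀ p, StrictMono fun s : ℝ => s + w (p + s • e)) :
    ∃ H : AmbientIsotopy, ∀ p, H.toHomeo 1 p = p + w p • e := by
  refine ⟨{
    toHomeo := fun t => (Equiv.ofBijective (fun p => p + ((t : ℝ) * w p) • e)
      ⟨push_injective hm t.2.1 t.2.2,
        push_surjective hw hC t.2.1 t.2.2⟩).toHomeomorphOfContinuousClosed
        (by change Continuous fun p => p + ((t : ℝ) * w p) • e; fun_prop)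
        (isClosedMap_push hw hR t)
    continuous' := ?_
    at_zero := ?_
    compactSupport := ⟨Metric.closedBall 0 R, isCompact_closedBall _ _, ?_⟩ }, ?_⟩
  · change Continuous fun q : unitInterval × Space => q.2 + ((q.1 : ℝ) * w q.2) • e
    fun_prop
  · intro p
    change p + (((0 : unitInterval) : ℝ) * w p) • e = p
    simp
  · intro t p hp
    change p + ((t : ℝ) * w p) • e = p
    rw [hR p (by simpa using (not_le.1 (by simpa using hp)).le)]
    simp
  · intro p
    change p + (((1 : unitInterval) : ℝ) * w p) • e = p + w p • e
    simp

/-- A compact set is isotopic to its image under a map that moves points along the lines of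
direction `e` and is strictly increasing on these lines. -/
theorem Isotopic.push {K : Set Space} (hK : IsCompact K) (e : Space) (hw : Continuous w)
    (hm : ∀ p, StrictMono fun s : ℝ => s + w (p + s • e)) :
    Isotopic K ((fun p => p + w p • e) '' K) := by
  obtain ⟨M, hM⟩ := (hK.image hw).isBounded.exists_norm_le
  obtain ⟨N, hN⟩ := hK.isBounded.exists_norm_le
  -- To get compact support, `w` is clamped between `-β` and `β` for a cone-shaped function `β`. It
  -- vanishes outside the ball of radius `R`, is at least `M` on the ball of radius `N` and so does
  -- not alter `w` on `K`, and varies along `e` with slope at most `‖e‖ / D < 1`.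
  set D : ℝ := 2 * (‖e‖ + 1) with hD
  have hDpos : 0 < D := by positivity
  set R : ℝ := N + D * M with hRdef
  let β : Space → ℝ := fun p => max 0 ((R - ‖p‖) / D)
  have hβ : Continuous β := by fun_prop
  have hβlip : ∀ p (a b : ℝ), a < b → |β (p + a • e) - β (p + b • e)| < b - a := by
    intro p a b hab
    have h1 : |β (p + a • e) - β (p + b • e)| ≤
        |(R - ‖p + a • e‖) / D - (R - ‖p + b • e‖) / D| := by
      simp only [β]
      rw [max_comm 0, max_comm 0]
      exact abs_max_sub_max_le_abs _ _ 0
    have h2 : (R - ‖p + a • e‖) / D - (R - ‖p + b • e‖) / D =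
        (‖p + b • e‖ - ‖p + a • e‖) / D := by ring
    have h3 : |‖p + b • e‖ - ‖p + a • e‖| ≤ (b - a) * ‖e‖ := by
      refine (abs_norm_sub_norm_le _ _).trans ?_
      rw [add_sub_add_left_eq_sub, ← sub_smul, norm_smul, Real.norm_eq_abs,
        abs_of_pos (sub_pos.2 hab)]
    refine h1.trans_lt ?_
    rw [h2, abs_div, abs_of_pos hDpos, div_lt_iff₀ hDpos]
    nlinarith [norm_nonneg e]
  let v : Space → ℝ := fun p => max (-β p) (min (w p) (β p))
  have hβ0 : ∀ p, 0 ≤ β p := fun p => le_max_left _ _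
  have hv : ∀ p, |v p| ≤ β p := fun p =>
    abs_le.2 ⟨le_max_left _ _, max_le (by linarith [hβ0 p]) (min_le_right _ _)⟩
  have hvK : ∀ p ∈ K, v p = w p := by
    intro p hp
    have h1 : |w p| ≤ M := hM _ ⟨p, hp, rfl⟩
    have h2 : M ≤ β p := by
      refine le_max_of_le_right ((le_div_iff₀ hDpos).2 ?_)
      have := hN p hp
      linarith
    obtain ⟨h3, h4⟩ := abs_le.1 (h1.trans h2)
    simp only [v]
    rw [min_eq_left h4, max_eq_right h3]
  have hex : ∃ H : AmbientIsotopy, ∀ p, H.toHomeo 1 p = p + v p • e := by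
    refine AmbientIsotopy.exists_push (R := R) (C := max 0 (R / D)) (by fun_prop) ?_ ?_ ?_
    · intro p hp
      have h : β p = 0 := max_eq_left (div_nonpos_of_nonpos_of_nonneg (by linarith) hDpos.le)
      have := hv p
      rw [h] at this
      exact abs_nonpos_iff.1 this
    · refine fun p => (hv p).trans (max_le_max le_rfl ?_)
      gcongr
      linarith [norm_nonneg p]
    · intro p a b hab
      have h1 := abs_lt.1 (hβlip p a b hab)
      have h2 := hm p hab
      simp only [v] at h2 ⊢
      -- `s + v` is the maximum of `s - β` and the minimum of `s + w` and `s + β`, and all three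
      -- increase strictly.
      rw [← max_add_add_left, ← max_add_add_left, ← min_add_add_left, ← min_add_add_left]
      exact max_lt_max (by linarith [h1.1]) (min_lt_min h2 (by linarith [h1.2]))
  obtain ⟨H, hH⟩ := hex
  refine ⟨H, Set.image_congr fun p hp => ?_⟩
  rw [hH, hvK p hp]

end Push

/-! ### Moving one compact set past another -/

open scoped Pointwise in
/-- The set swept out by `X` when it moves in the direction `e`. -/
def sweep (e : Space) (X : Set Space) : Set Space :=
  X + (fun t : ℝ => t • e) '' Set.Ici 0

open scoped Pointwise in
theorem mem_sweep {e p : Space} {X : Set Space} :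
    p ∈ sweep e X ↔ ∃ x ∈ X, ∃ t : ℝ, 0 ≤ t ∧ x + t • e = p := by
  simp only [sweep, Set.mem_add, Set.mem_image, Set.mem_Ici, exists_exists_and_eq_and]

theorem subset_sweep (e : Space) (X : Set Space) : X ⊆ sweep e X :=
  fun p hp => mem_sweep.2 ⟨p, hp, 0, le_rfl, by simp⟩

open scoped Pointwise in
theorem isClosed_sweep (e : Space) {X : Set Space} (hX : IsCompact X) :
    IsClosed (sweep e X) := by
  refine IsClosed.add_left_of_isCompact ?_ hX
  by_cases he : e = 0
  · subst he
    simp [Set.Nonempty.image_const Set.nonempty_Ici]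
  · exact (isClosedEmbedding_smul_left he).isClosedMap _ isClosed_Ici

/-- Translation by a nonnegative multiple of `e` maps the sweep into itself, so a point moving along
`e` cannot get farther from it. -/
theorem antitone_infDist_sweep (e : Space) {X : Set Space} (hX : X.Nonempty) (p : Space) :
    Antitone fun s : ℝ => Metric.infDist (p + s • e) (sweep e X) := by
  intro a b hab
  refine (Metric.le_infDist (hX.mono (subset_sweep e X))).2 fun q hq => ?_
  obtain ⟨x, hx, t, ht, rfl⟩ := mem_sweep.1 hq
  refine (Metric.infDist_le_dist_of_mem
    (mem_sweep.2 ⟨x, hx, t + (b - a), by linarith, rfl⟩)).trans_eq ?_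
  rw [dist_eq_norm, dist_eq_norm]
  congr 1
  module

/-- The compact set `B` may be translated by `e` if on its way it does not meet `A`. -/
theorem Isotopic.translate_right {A B : Set Space} (hA : IsCompact A) (hB : IsCompact B)
    (hA' : A.Nonempty) (hB' : B.Nonempty) (e : Space)
    (h : ∀ b ∈ B, ∀ t : ℝ, 0 ≤ t → b + t • e ∉ A) :
    Isotopic (A ∪ B) (A ∪ (fun p => p + e) '' B) := by
  -- The hypothesis says that the sweep of `B` along `e` misses the sweep of `A` along `-e`, so `a +
  -- b` never vanishes. The quotient `a / (a + b)` is `0` on `A` and `1` on `B`. Along `e` it never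
  -- decreases, since `a` does not decrease and `b` does not increase.
  let a : Space → ℝ := fun p => Metric.infDist p (sweep (-e) A)
  let b : Space → ℝ := fun p => Metric.infDist p (sweep e B)
  have ha0 : ∀ p, 0 ≤ a p := fun p => Metric.infDist_nonneg
  have hb0 : ∀ p, 0 ≤ b p := fun p => Metric.infDist_nonneg
  have hab : ∀ p, 0 < a p + b p := by
    intro p
    by_contra! hp
    have h1 : a p = 0 := by linarith [ha0 p, hb0 p]
    have h2 : b p = 0 := by linarith [ha0 p, hb0 p]
    obtain ⟨x, hx, t, ht, hxt⟩ := mem_sweep.1 (((isClosed_sweep (-e) hA).mem_iff_infDist_zero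
      (hA'.mono (subset_sweep _ A))).2 h1)
    obtain ⟨y, hy, u, hu, hyu⟩ := mem_sweep.1 (((isClosed_sweep e hB).mem_iff_infDist_zero
      (hB'.mono (subset_sweep _ B))).2 h2)
    refine h y hy (u + t) (by linarith) ?_
    rw [add_smul, ← add_assoc, hyu, ← hxt, smul_neg, neg_add_cancel_right]
    exact hx
  let w : Space → ℝ := fun p => a p / (a p + b p)
  have ha : Continuous a := Metric.continuous_infDist_pt _
  have hb : Continuous b := Metric.continuous_infDist_pt _
  have hw : Continuous w := ha.div (ha.add hb) fun p => (hab p).ne'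
  have hwA : ∀ p ∈ A, w p = 0 := fun p hp => by
    simp [w, a, Metric.infDist_zero_of_mem (subset_sweep (-e) A hp)]
  have hwB : ∀ p ∈ B, w p = 1 := fun p hp => by
    have h1 : b p = 0 := Metric.infDist_zero_of_mem (subset_sweep e B hp)
    have h2 := hab p
    simp only [w]
    rw [h1, add_zero] at h2 ⊢
    exact div_self h2.ne'
  have key : Isotopic (A ∪ B) ((fun p => p + w p • e) '' (A ∪ B)) := by
    refine Isotopic.push (hA.union hB) e hw fun p => ?_
    refine strictMono_id.add_monotone fun s s' hs => ?_
    have h1 : a (p + s • e) ≤ a (p + s' • e) := by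
      simpa [a] using antitone_infDist_sweep (-e) hA' p (neg_le_neg hs)
    have h2 : b (p + s' • e) ≤ b (p + s • e) := antitone_infDist_sweep e hB' p hs
    simp only [w]
    rw [div_le_div_iff₀ (hab _) (hab _)]
    nlinarith [mul_le_mul h1 h2 (hb0 _) (ha0 _)]
  rw [Set.image_union] at key
  convert key using 2
  · refine ((Set.image_congr fun p hp => ?_).trans (Set.image_id A)).symm
    simp [hwA p hp]
  · refine Set.image_congr fun p hp => ?_
    simp [hwB p hp]

theorem Isotopic.translate_left {A B : Set Space} (hA : IsCompact A) (hB : IsCompact B)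
    (hA' : A.Nonempty) (hB' : B.Nonempty) (e : Space)
    (h : ∀ a ∈ A, ∀ t : ℝ, 0 ≤ t → a + t • e ∉ B) :
    Isotopic (A ∪ B) ((fun p => p + e) '' A ∪ B) := by
  rw [Set.union_comm, Set.union_comm _ B]
  exact Isotopic.translate_right hB hA hB' hA' e h

/-! ### Splitting a union of two links -/

theorem Isotopic.map_fst {K : Set Space} (hK : IsCompact K) {φ : ℝ → ℝ} (hφ : StrictMono φ)
    (hc : Continuous φ) : Isotopic K ((fun p => (φ p.1, p.2)) '' K) := by
  convert Isotopic.push (w := fun p => φ p.1 - p.1) hK (1, 0, 0) (by fun_prop) ?_ using 2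
  · ext <;> simp
  · intro p a b hab
    have := hφ (add_lt_add_right hab p.1)
    simp
    linarith

theorem Isotopic.map_snd {K : Set Space} (hK : IsCompact K) {ψ : ℝ → ℝ} (hψ : StrictMono ψ)
    (hc : Continuous ψ) : Isotopic K ((fun p => (p.1, ψ p.2.1, p.2.2)) '' K) := by
  convert Isotopic.push (w := fun p => ψ p.2.1 - p.2.1) hK (0, 1, 0) (by fun_prop) ?_ using 2
  · ext <;> simp
  · intro p a b hab
    have := hψ (add_lt_add_right hab p.2.1)
    simp
    linarith

/-- If `B` can be moved away from `A` in the direction of the `z`-axis, then `A` and `B` can be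
moved to different sides of the plane `x = 0`. -/
theorem Isotopic.split {A B : Set Space} (hA : IsCompact A) (hB : IsCompact B)
    (hA' : A.Nonempty) (hB' : B.Nonempty) {σ : ℝ} (hσ : |σ| = 1)
    (h : ∀ a ∈ A, ∀ b ∈ B, a.1 = b.1 → a.2.1 = b.2.1 → 0 < σ * (a.2.2 - b.2.2)) :
    ∃ R : ℝ, (∀ p ∈ A, 0 < p.1 + R) ∧ (∀ p ∈ B, p.1 - R < 0) ∧
      Isotopic (A ∪ B) ((fun p => (p.1 + R, p.2)) '' A ∪ (fun p => (p.1 - R, p.2)) '' B) := by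
  obtain ⟨N, hN⟩ := (hA.union hB).isBounded.exists_norm_le
  have hσ0 : σ * σ = 1 := by rw [← abs_mul_abs_self, hσ, one_mul]
  have hN0 : 0 ≤ N := (norm_nonneg _).trans (hN _ (Or.inl hA'.some_mem))
  have hx : ∀ p ∈ A ∪ B, |p.1| ≤ N := fun p hp => (norm_fst_le p).trans (hN p hp)
  have hz : ∀ p ∈ A ∪ B, |p.2.2| ≤ N := fun p hp =>
    ((norm_snd_le p.2).trans (norm_snd_le p)).trans (hN p hp)
  -- A shift by `M` exceeds the extent of `A ∪ B` in each of the directions `x` and `z`. `B` moves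
  -- in depth by `e`, left by `-d` and back by `-e`; then `A` moves right by `d`. Each move keeps
  -- clear of the other set.
  set M : ℝ := 2 * N + 1 with hM
  have hσz : ∀ p ∈ A ∪ B, |σ * p.2.2| ≤ N := fun p hp => by
    rw [abs_mul, hσ, one_mul]
    exact hz p hp
  let e : Space := (0, 0, -(σ * M))
  let d : Space := (M, 0, 0)
  have cont : ∀ v : Space, Continuous fun p : Space => p + v := fun v => by fun_prop
  have h1 : Isotopic (A ∪ B) (A ∪ (fun p => p + e) '' B) := by
    refine Isotopic.translate_right hA hB hA' hB' e fun b hb t ht hmem => ?_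
    have := h _ hmem b hb (by simp [e]) (by simp [e])
    simp only [e, Prod.smul_mk, smul_eq_mul, Prod.snd_add] at this
    nlinarith [mul_nonneg ht (by linarith : (0 : ℝ) ≤ M)]
  have h2 : Isotopic (A ∪ (fun p => p + e) '' B)
      (A ∪ (fun p => p + -d) '' ((fun p => p + e) '' B)) := by
    refine Isotopic.translate_right hA (hB.image (cont e)) hA' (hB'.image _) (-d) ?_
    rintro _ ⟨b, hb, rfl⟩ t ht hmem
    have i1 := abs_le.1 (hσz _ (Or.inl hmem))
    have i2 := abs_le.1 (hσz b (Or.inr hb))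
    simp only [e, d, Prod.neg_mk, neg_zero, Prod.smul_mk, smul_eq_mul, Prod.snd_add, mul_zero,
      add_zero] at i1
    nlinarith [i1.1, i2.2]
  have h3 : Isotopic (A ∪ (fun p => p + -d) '' ((fun p => p + e) '' B))
      (A ∪ (fun p => p + -e) '' ((fun p => p + -d) '' ((fun p => p + e) '' B))) := by
    refine Isotopic.translate_right hA ((hB.image (cont e)).image (cont (-d))) hA'
      ((hB'.image _).image _) (-e) ?_
    rintro _ ⟨_, ⟨b, hb, rfl⟩, rfl⟩ t ht hmem
    have i1 := abs_le.1 (hx _ (Or.inl hmem))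
    have i2 := abs_le.1 (hx b (Or.inr hb))
    simp only [e, d, Prod.neg_mk, neg_zero, Prod.smul_mk, smul_eq_mul, Prod.fst_add, mul_zero,
      add_zero] at i1
    linarith [i1.1, i2.2]
  have e3 : (fun p => p + -e) '' ((fun p => p + -d) '' ((fun p => p + e) '' B)) =
      (fun p => (p.1 - M, p.2)) '' B := by
    rw [← Set.image_comp, ← Set.image_comp]
    refine Set.image_congr fun p _ => ?_
    ext <;> simp [e, d, sub_eq_add_neg]
  have hB3 : IsCompact ((fun p : Space => (p.1 - M, p.2)) '' B) :=
    hB.image (by fun_prop)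
  have h4 : Isotopic (A ∪ (fun p => (p.1 - M, p.2)) '' B)
      ((fun p => p + d) '' A ∪ (fun p => (p.1 - M, p.2)) '' B) := by
    refine Isotopic.translate_left hA hB3 hA' (hB'.image _) d ?_
    rintro a ha t ht ⟨b, hb, hab⟩
    have i1 := abs_le.1 (hx a (Or.inl ha))
    have i2 := abs_le.1 (hx b (Or.inr hb))
    have i3 := congrArg Prod.fst hab
    simp only [d, Prod.smul_mk, smul_eq_mul, Prod.fst_add] at i3
    nlinarith [i1.1, i2.2, mul_nonneg ht (by linarith : (0 : ℝ) ≤ M)]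
  have e4 : (fun p => p + d) '' A = (fun p => (p.1 + M, p.2)) '' A :=
    Set.image_congr fun p _ => by ext <;> simp [d]
  refine ⟨M, fun p hp => ?_, fun p hp => ?_, ?_⟩
  · linarith [(abs_le.1 (hx p (Or.inl hp))).1]
  · linarith [(abs_le.1 (hx p (Or.inr hp))).2]
  · rw [e3] at h3
    rw [e4] at h4
    exact ((h1.trans h2).trans h3).trans h4

/-- `P` is `A` in logarithmic coordinates: `exp` turns it into the translate of `A`, while the
increasing function `exp - R` recovers `A` itself by an isotopy. -/
theorem exists_intoRight {A : Set Space} (hA : IsCompact A) {R : ℝ}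
    (h : ∀ p ∈ A, 0 < p.1 + R) :
    ∃ P, Isotopic P A ∧ intoRight '' P = (fun p => (p.1 + R, p.2)) '' A := by
  refine ⟨(fun p => (Real.log (p.1 + R), p.2)) '' A, ?_, ?_⟩
  · have hc : IsCompact ((fun p : Space => (Real.log (p.1 + R), p.2)) '' A) := by
      refine hA.image_of_continuousOn (ContinuousOn.prodMk ?_ continuous_snd.continuousOn)
      exact ContinuousOn.log (by fun_prop) fun p hp => (h p hp).ne'
    convert Isotopic.map_fst hc (φ := fun x => Real.exp x - R)
      (fun a b hab => sub_lt_sub_right (Real.exp_lt_exp.2 hab) R) (by fun_prop)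
    rw [← Set.image_comp]
    refine ((Set.image_congr fun p hp => ?_).trans (Set.image_id A)).symm
    simp [Real.exp_log (h p hp)]
  · rw [← Set.image_comp]
    refine Set.image_congr fun p hp => ?_
    simp [intoRight, Real.exp_log (h p hp)]

theorem exists_intoLeft {A : Set Space} (hA : IsCompact A) {R : ℝ}
    (h : ∀ p ∈ A, p.1 - R < 0) :
    ∃ P, Isotopic P A ∧ intoLeft '' P = (fun p => (p.1 - R, p.2)) '' A := by
  have h' : ∀ p ∈ A, 0 < R - p.1 := fun p hp => by linarith [h p hp]
  refine ⟨(fun p => (-Real.log (R - p.1), p.2)) '' A, ?_, ?_⟩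
  · have hc : IsCompact ((fun p : Space => (-Real.log (R - p.1), p.2)) '' A) := by
      refine hA.image_of_continuousOn (ContinuousOn.prodMk ?_ continuous_snd.continuousOn)
      exact (ContinuousOn.log (by fun_prop) fun p hp => (h' p hp).ne').neg
    convert Isotopic.map_fst hc (φ := fun x => R - Real.exp (-x))
      (fun a b hab => sub_lt_sub_left (Real.exp_lt_exp.2 (neg_lt_neg hab)) R) (by fun_prop)
    rw [← Set.image_comp]
    refine ((Set.image_congr fun p hp => ?_).trans (Set.image_id A)).symm
    simp [Real.exp_log (h' p hp)]
  · rw [← Set.image_comp]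
    refine Set.image_congr fun p hp => ?_
    simp [intoLeft, Real.exp_log (h' p hp)]

/-- `B` ends up in the left half-space and therefore comes first in the disjoint union. -/
theorem mk_union_eq_disjointUnion {A B : Set Space} (hA : IsCompact A) (hB : IsCompact B)
    (hA' : A.Nonempty) (hB' : B.Nonempty) {σ : ℝ} (hσ : |σ| = 1)
    (h : ∀ a ∈ A, ∀ b ∈ B, a.1 = b.1 → a.2.1 = b.2.1 → 0 < σ * (a.2.2 - b.2.2)) :
    (Quotient.mk isotopySetoid (A ∪ B) : IsotopyClass) =
      IsotopyClass.disjointUnion (Quotient.mk isotopySetoid B) (Quotient.mk isotopySetoid A) := by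
  obtain ⟨R, hR1, hR2, hR⟩ := Isotopic.split hA hB hA' hB' hσ h
  obtain ⟨P, hP, eP⟩ := exists_intoRight hA hR1
  obtain ⟨Q, hQ, eQ⟩ := exists_intoLeft hB hR2
  have sP : Quotient.mk isotopySetoid P = Quotient.mk isotopySetoid A := Quotient.sound hP
  have sQ : Quotient.mk isotopySetoid Q = Quotient.mk isotopySetoid B := Quotient.sound hQ
  rw [← sP, ← sQ]
  refine Quotient.sound ?_
  rw [← eP, ← eQ, Set.union_comm (intoRight '' P)] at hR
  exact hR

/-! ### Stretching diagrams -/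

/-- For `q ≤ p` this is translation by `k` between `q` and `p`, continued with slope `1 + a` to the
right and `1 + b` to the left. -/
theorem exists_bend {a b : ℝ} (ha : 0 ≤ a) (hb : 0 ≤ b) (k p q : ℝ) :
    ∃ ψ : ℝ ≃o ℝ, ∀ x, ψ x = x + k + a * max 0 (x - p) - b * max 0 (q - x) := by
  let f : ℝ → ℝ := fun x => x + k + a * max 0 (x - p) - b * max 0 (q - x)
  have hm : StrictMono f := by
    intro x y hxy
    have h1 : a * max 0 (x - p) ≤ a * max 0 (y - p) := by gcongr
    have h2 : b * max 0 (q - y) ≤ b * max 0 (q - x) := by gcongr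
    simp only [f]
    linarith
  have hs : Function.Surjective f := by
    refine Continuous.surjective (by fun_prop) ?_ ?_
    · refine Filter.tendsto_atTop_mono' _ ?_
        (Filter.tendsto_atTop_add_const_right _ k Filter.tendsto_id)
      filter_upwards [Filter.eventually_ge_atTop q] with x hx
      have h1 : 0 ≤ a * max 0 (x - p) := by positivity
      have h2 : max 0 (q - x) = 0 := max_eq_left (by linarith)
      simp only [f, h2, id]
      linarith
    · refine Filter.tendsto_atBot_mono' _ ?_
        (Filter.tendsto_atBot_add_const_right _ k Filter.tendsto_id)
      filter_upwards [Filter.eventually_le_atBot p] with x hx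
      have h1 : 0 ≤ b * max 0 (q - x) := by positivity
      have h2 : max 0 (x - p) = 0 := max_eq_left (by linarith)
      simp only [f, h2, id]
      linarith
  exact ⟨hm.orderIsoOfSurjective f hs, fun x => rfl⟩

/-- The map that applies `φ` and `ψ` to the coordinates of the plane of the diagram. -/
def stretch (φ ψ : ℝ ≃o ℝ) (p : Space) : Space := (φ p.1, ψ p.2.1, p.2.2)

/-- The reflection of the plane of the diagram in the line `y = 0`. -/
def reflect (p : Space) : Space := (p.1, -p.2.1, p.2.2)

/-- The conjugate of `ψ` by the reflection in `0`. -/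
def negConj (ψ : ℝ ≃o ℝ) : ℝ ≃o ℝ where
  toFun y := -ψ (-y)
  invFun y := -ψ.symm (-y)
  left_inv y := by simp
  right_inv y := by simp
  map_rel_iff' := by simp

/-- Reduces the stretching of the reflected lower tree to that of an upright one. -/
theorem stretch_comp_reflect (φ ψ : ℝ ≃o ℝ) :
    stretch φ ψ ∘ reflect = reflect ∘ stretch φ (negConj ψ) := by
  funext p
  simp [stretch, reflect, negConj]

theorem isotopic_stretch {K : Set Space} (hK : IsCompact K) (φ ψ : ℝ ≃o ℝ) :
    Isotopic K (stretch φ ψ '' K) := by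
  have hφ := φ.continuous
  have h := (Isotopic.map_fst hK φ.strictMono φ.continuous).trans
    (Isotopic.map_snd (hK.image (by fun_prop)) ψ.strictMono ψ.continuous)
  rwa [← Set.image_comp] at h

theorem mem_image_stretch {φ ψ : ℝ ≃o ℝ} {K : Set Space} {p : Space} :
    p ∈ stretch φ ψ '' K ↔ (φ.symm p.1, ψ.symm p.2.1, p.2.2) ∈ K := by
  constructor
  · rintro ⟨q, hq, rfl⟩
    simpa [stretch] using hq
  · intro h
    exact ⟨_, h, by simp [stretch]⟩

theorem image_column (φ ψ : ℝ ≃o ℝ) (x a b : ℝ) :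
    stretch φ ψ '' column x a b = column (φ x) (ψ a) (ψ b) := by
  ext p
  rw [mem_image_stretch]
  simp [column, OrderIso.symm_apply_eq, OrderIso.le_symm_apply, OrderIso.symm_apply_le]

theorem image_bridge (c : CrossingRule) (φ ψ : ℝ ≃o ℝ) (y a b : ℝ) :
    stretch φ ψ '' bridge c y a b = bridge c (ψ y) (φ a) (φ b) := by
  ext p
  rw [mem_image_stretch]
  simp [bridge, OrderIso.symm_apply_eq, OrderIso.le_symm_apply, OrderIso.symm_apply_le]

theorem isCompact_column (x a b : ℝ) : IsCompact (column x a b) := by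
  have : column x a b = {x} ×ˢ Set.Icc a b ×ˢ {0} := by
    ext p
    simp [column]
  rw [this]
  exact isCompact_singleton.prod (isCompact_Icc.prod isCompact_singleton)

theorem isCompact_bridge (c : CrossingRule) (y a b : ℝ) : IsCompact (bridge c y a b) := by
  have : bridge c y a b = Set.Icc a b ×ˢ {y} ×ˢ {c.level} ∪
      {a, b} ×ˢ {y} ×ˢ Set.uIcc 0 c.level := by
    ext p
    simp only [bridge, Set.mem_ofPred_eq, Set.mem_union, Set.mem_prod, Set.mem_singleton_iff,
      Set.mem_insert_iff]
    tauto
  rw [this]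
  exact (isCompact_Icc.prod (isCompact_singleton.prod isCompact_singleton)).union
    ((Set.toFinite _).isCompact.prod (isCompact_singleton.prod isCompact_uIcc))

theorem continuous_reflect : Continuous reflect := by
  unfold reflect
  fun_prop

theorem reflect_bridge (c : CrossingRule) (y a b : ℝ) :
    reflect '' bridge c y a b = bridge c (-y) a b := by
  ext ⟨u, v, w⟩
  constructor
  · rintro ⟨q, ⟨h1, h2⟩, h⟩
    obtain ⟨rfl, rfl, rfl⟩ : q.1 = u ∧ -q.2.1 = v ∧ q.2.2 = w := by
      simpa [reflect] using h
    exact ⟨neg_inj.2 h1, h2⟩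
  · rintro ⟨h1, h2⟩
    exact ⟨(u, -v, w), ⟨neg_eq_iff_eq_neg.2 h1, h2⟩, by simp [reflect]⟩

theorem column_union_reflect (x : ℝ) {a b : ℝ} (ha : 0 ≤ a) (hb : 0 ≤ b) :
    column x 0 b ∪ reflect '' column x 0 a = column x (-a) b := by
  ext ⟨u, v, w⟩
  simp only [Set.mem_union, Set.mem_image, column, reflect, Set.mem_ofPred_eq, Set.mem_Icc]
  constructor
  · rintro (⟨h1, ⟨h2, h3⟩, h4⟩ | ⟨q, ⟨h1, ⟨h2, h3⟩, h4⟩, h⟩)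
    · exact ⟨h1, ⟨by linarith, h3⟩, h4⟩
    · simp only [Prod.mk.injEq] at h
      obtain ⟨r1, r2, r3⟩ := h
      exact ⟨by linarith, ⟨by linarith, by linarith⟩, by linarith⟩
  · rintro ⟨h1, ⟨h2, h3⟩, h4⟩
    rcases le_total 0 v with h | h
    · exact Or.inl ⟨h1, ⟨h, h3⟩, h4⟩
    · exact Or.inr ⟨(u, -v, w), ⟨h1, ⟨by simpa using h, by simp; linarith⟩, h4⟩, by simp⟩

/-! ### Drawings of trees and their closures -/

namespace TernaryTree

theorem rootColumn_lt (T : TernaryTree) : T.rootColumn < T.numLeaves := by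
  induction T with
  | leaf => exact Nat.one_pos
  | node l m r hl hm hr => simp only [rootColumn, numLeaves]; omega

theorem isCompact_draw (c : CrossingRule) (T : TernaryTree) :
    ∀ k y, IsCompact (T.draw c k y) := by
  induction T with
  | leaf => exact fun k y => isCompact_column _ _ _
  | node l m r hl hm hr =>
    exact fun k y => (((hl _ _).union (hm _ _)).union (hr _ _)).union (isCompact_bridge _ _ _ _)

/-- A drawing involves only leaf columns, integer heights up to that of the tree, and the end `y` of
the root edge; the values there determine the image. -/
theorem image_draw (c : CrossingRule) (φ ψ : ℝ ≃o ℝ) (T : TernaryTree) :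
    ∀ k k' y y' : ℕ, (∀ i < T.numLeaves, φ ((k + i : ℕ) : ℝ) = ((k' + i : ℕ) : ℝ)) →
      (∀ j ≤ T.height, ψ ((j : ℕ) : ℝ) = j) → ψ (y : ℝ) = y' →
      stretch φ ψ '' T.draw c k y = T.draw c k' y' := by
  induction T with
  | leaf =>
    intro k k' y y' hφ hψ hy
    have h0 := hφ 0 Nat.one_pos
    have h1 := hψ 0 le_rfl
    simp only [add_zero, Nat.cast_zero] at h0 h1
    rw [draw, draw, image_column, h0, h1, hy]
  | node l m r hl hm hr =>
    intro k k' y y' hφ hψ hy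
    have ll := l.rootColumn_lt
    have lr := r.rootColumn_lt
    simp only [numLeaves] at hφ
    have hh := hψ _ le_rfl
    have e1 := hφ l.rootColumn (by omega)
    have e2 := hφ (l.numLeaves + m.numLeaves + r.rootColumn) (by omega)
    simp only [← add_assoc] at e2
    simp only [draw, Set.image_union, image_bridge]
    rw [hl k k' _ _ (fun i hi => hφ i (by omega)) (fun j hj => hψ j (by simp [height]; omega)) hh,
      hm (k + l.numLeaves) (k' + l.numLeaves) y y'
        (fun i hi => by simpa only [← add_assoc] using hφ (l.numLeaves + i) (by omega))
        (fun j hj => hψ j (by simp [height]; omega)) hy,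
      hr (k + l.numLeaves + m.numLeaves) (k' + l.numLeaves + m.numLeaves) _ _
        (fun i hi => by
          simpa only [← add_assoc] using hφ (l.numLeaves + m.numLeaves + i) (by omega))
        (fun j hj => hψ j (by simp [height]; omega)) hh, hh, e1, e2]

/-- The last alternative holds because above the topmost vertex only the root edge remains, and it
is vertical. -/
theorem draw_bounds (c : CrossingRule) (T : TernaryTree) :
    ∀ k y : ℕ, T.height ≤ y → ∀ p ∈ T.draw c k y, (k : ℝ) ≤ p.1 ∧ p.1 + 1 ≤ k + T.numLeaves ∧
      0 ≤ p.2.1 ∧ p.2.1 ≤ y ∧ (p.2.1 ≤ T.height ∨ p.2.2 = 0) := by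
  induction T with
  | leaf =>
    rintro k y hy p ⟨h1, ⟨h2, h3⟩, h4⟩
    simp only [numLeaves]
    exact ⟨h1.ge, by rw [h1]; simp, h2, h3, Or.inr h4⟩
  | node l m r hl hm hr =>
    intro k y hy p hp
    have ll := l.rootColumn_lt
    have lr := r.rootColumn_lt
    have hl' : l.height ≤ (node l m r).height := by simp [height]; omega
    have hm' : m.height ≤ (node l m r).height := by simp [height]; omega
    have hr' : r.height ≤ (node l m r).height := by simp [height]; omega
    have cy : ((node l m r).height : ℝ) ≤ y := by exact_mod_cast hy
    have cm : (m.height : ℝ) ≤ (node l m r).height := by exact_mod_cast hm'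
    have ll' : (l.rootColumn : ℝ) + 1 ≤ l.numLeaves := by exact_mod_cast ll
    have lr' : (r.rootColumn : ℝ) + 1 ≤ r.numLeaves := by exact_mod_cast lr
    have n0 : (0 : ℝ) ≤ l.rootColumn := Nat.cast_nonneg _
    have n1 : (0 : ℝ) ≤ r.rootColumn := Nat.cast_nonneg _
    have n2 : (0 : ℝ) ≤ m.numLeaves := Nat.cast_nonneg _
    have n3 : (0 : ℝ) ≤ (node l m r).height := Nat.cast_nonneg _
    simp only [numLeaves]
    push_cast
    rcases hp with ((hp | hp) | hp) | hp
    · obtain ⟨h1, h2, h3, h4, h5⟩ := hl _ _ hl' p hp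
      exact ⟨h1, by linarith, h3, by linarith, Or.inl h4⟩
    · obtain ⟨h1, h2, h3, h4, h5⟩ := hm _ _ (hm'.trans hy) p hp
      push_cast at h1 h2
      exact ⟨by linarith, by linarith, h3, by linarith, h5.imp_left fun h => by linarith⟩
    · obtain ⟨h1, h2, h3, h4, h5⟩ := hr _ _ hr' p hp
      push_cast at h1 h2
      exact ⟨by linarith, by linarith, h3, by linarith, Or.inl h4⟩
    · obtain ⟨h1, h2⟩ := hp
      have hx : p.1 ∈ Set.Icc ((k + l.rootColumn : ℕ) : ℝ)
          ((k + l.numLeaves + m.numLeaves + r.rootColumn : ℕ) : ℝ) := by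
        have hle : ((k + l.rootColumn : ℕ) : ℝ) ≤
          ((k + l.numLeaves + m.numLeaves + r.rootColumn : ℕ) : ℝ) := by
          exact_mod_cast (by omega)
        rcases h2 with ⟨h2, -⟩ | ⟨h2 | h2, -⟩
        · exact h2
        · rw [h2]
          exact Set.left_mem_Icc.2 hle
        · rw [h2]
          exact Set.right_mem_Icc.2 hle
      obtain ⟨h3, h4⟩ := hx
      push_cast at h3 h4
      exact ⟨by linarith, by linarith, by linarith, by linarith, Or.inl h1.le⟩

/-- The drawings of two trees with first leaves at `x = k`, whose roots at the heights `Y` and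
`-Y'` are joined by an arc through the column `X`. -/
def closedDiagram (c : CrossingRule) (T S : TernaryTree) (k Y Y' X : ℕ) : Set Space :=
  T.draw c k Y ∪ reflect '' S.draw c k Y' ∪
  (bridge c Y ((k + T.rootColumn : ℕ) : ℝ) X ∪ column X (-Y') Y ∪
    bridge c (-Y') ((k + S.rootColumn : ℕ) : ℝ) X)

theorem isCompact_closedDiagram (c : CrossingRule) (T S : TernaryTree) (k Y Y' X : ℕ) :
    IsCompact (closedDiagram c T S k Y Y' X) :=
  ((isCompact_draw c T k Y).union ((isCompact_draw c S k Y').image continuous_reflect)).union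
    (((isCompact_bridge _ _ _ _).union (isCompact_column _ _ _)).union (isCompact_bridge _ _ _ _))

theorem closedDiagram_nonempty (c : CrossingRule) (T S : TernaryTree) (k Y Y' X : ℕ) :
    (closedDiagram c T S k Y Y' X).Nonempty :=
  ⟨(X, 0, 0), Or.inr (Or.inl (Or.inr ⟨rfl, by simp, rfl⟩))⟩

theorem link_eq_closedDiagram (c : CrossingRule) (T S : TernaryTree) :
    T.link c S = closedDiagram c T S 0 (T.height + 1) (S.height + 1) T.numLeaves := by
  unfold link closedDiagram
  push_cast
  simp only [zero_add]
  rfl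

theorem isotopic_closedDiagram (c : CrossingRule) {T S : TernaryTree}
    (hn : T.numLeaves = S.numLeaves) {k Y Y' X : ℕ} (hY : T.height < Y) (hY' : S.height < Y')
    (hX : k + T.numLeaves ≤ X) :
    Isotopic (T.link c S) (closedDiagram c T S k Y Y' X) := by
  have cY : (T.height : ℝ) + 1 ≤ Y := by exact_mod_cast hY
  have cY' : (S.height : ℝ) + 1 ≤ Y' := by exact_mod_cast hY'
  have cX : (k : ℝ) + T.numLeaves ≤ X := by exact_mod_cast hX
  -- `φ` shifts the leaf columns by `k` and stretches only beyond the last of them, so that the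
  -- closing column reaches `X`. `ψ` fixes the range of heights of both trees and moves only the
  -- root ends, to `Y` and `-Y'`.
  obtain ⟨φ, hφ⟩ := exists_bend (a := X - k - T.numLeaves) (b := 0) (by linarith) le_rfl
    k (T.numLeaves - 1) 0
  obtain ⟨ψ, hψ⟩ := exists_bend (a := Y - T.height - 1) (b := Y' - S.height - 1)
    (by linarith) (by linarith) 0 T.height (-S.height)
  have φ1 : ∀ i < T.numLeaves, φ ((0 + i : ℕ) : ℝ) = ((k + i : ℕ) : ℝ) := by
    intro i hi
    have : (i : ℝ) + 1 ≤ T.numLeaves := by exact_mod_cast hi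
    rw [hφ, zero_add, max_eq_left (by linarith)]
    push_cast
    ring
  have φ2 : φ (T.numLeaves : ℝ) = X := by
    rw [hφ, max_eq_right (by linarith)]
    ring
  have hT0 : (0 : ℝ) ≤ T.height := Nat.cast_nonneg _
  have hS0 : (0 : ℝ) ≤ S.height := Nat.cast_nonneg _
  have ψ1 : ∀ j ≤ T.height, ψ ((j : ℕ) : ℝ) = j := by
    intro j hj
    have h1 : (j : ℝ) ≤ T.height := by exact_mod_cast hj
    have h2 : (0 : ℝ) ≤ j := Nat.cast_nonneg _
    rw [hψ, max_eq_left (by linarith), max_eq_left (by linarith)]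
    ring
  have ψ2 : ψ ((T.height + 1 : ℕ) : ℝ) = Y := by
    push_cast
    rw [hψ, max_eq_right (by linarith), max_eq_left (by linarith)]
    ring
  have ψ3 : ∀ j ≤ S.height, negConj ψ ((j : ℕ) : ℝ) = j := by
    intro j hj
    have h1 : (j : ℝ) ≤ S.height := by exact_mod_cast hj
    have h2 : (0 : ℝ) ≤ j := Nat.cast_nonneg _
    change -ψ (-(j : ℝ)) = j
    rw [hψ, max_eq_left (by linarith), max_eq_left (by linarith)]
    ring
  have ψ4 : ψ (-((S.height + 1 : ℕ) : ℝ)) = -Y' := by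
    push_cast
    rw [hψ, max_eq_left (by linarith), max_eq_right (by linarith)]
    ring
  have ψ5 : negConj ψ ((S.height + 1 : ℕ) : ℝ) = Y' := neg_eq_iff_eq_neg.2 ψ4
  rw [link_eq_closedDiagram]
  convert isotopic_stretch (isCompact_closedDiagram _ _ _ _ _ _ _) φ ψ using 1
  unfold closedDiagram
  simp only [Set.image_union]
  rw [← Set.image_comp (stretch φ ψ) reflect, stretch_comp_reflect, Set.image_comp,
    image_draw c φ ψ T 0 k _ Y φ1 ψ1 ψ2, image_draw c φ (negConj ψ) S 0 k _ Y' (hn ▸ φ1) ψ3 ψ5,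
    image_bridge, image_bridge, image_column, ψ2, ψ4, φ2, φ1 _ T.rootColumn_lt,
    φ1 _ (hn ▸ S.rootColumn_lt)]

/-- The edges of the two right leaves form one column at `A.numLeaves + B.numLeaves`. With the
bridges of the two root crossings it is an arc that closes `(A, A')`. The root edges of `B` and `B'`
continue through these crossings, one unit higher and lower, to the outer arc, which closes `(B,
B')`. -/
theorem link_node_leaf (c : CrossingRule) {A A' B B' : TernaryTree}
    (hA : A.numLeaves = A'.numLeaves) (hB : B.numLeaves = B'.numLeaves) :
    (node A B leaf).link c (node A' B' leaf) =
      closedDiagram c A A' 0 (node A B leaf).height (node A' B' leaf).height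
        (A.numLeaves + B.numLeaves) ∪
      closedDiagram c B B' A.numLeaves ((node A B leaf).height + 1)
        ((node A' B' leaf).height + 1) (A.numLeaves + B.numLeaves + 1) := by
  have e1 : (node A' B' leaf).draw c 0 ((node A' B' leaf).height + 1) =
      A'.draw c 0 (node A' B' leaf).height ∪
      B'.draw c A.numLeaves ((node A' B' leaf).height + 1) ∪
      column ((A.numLeaves + B.numLeaves : ℕ) : ℝ) 0 (node A' B' leaf).height ∪
      bridge c (node A' B' leaf).height ((0 + A'.rootColumn : ℕ) : ℝ)
        ((A.numLeaves + B.numLeaves : ℕ) : ℝ) := by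
    simp only [draw, rootColumn, zero_add, add_zero, hA, hB]
  have e2 : (node A B leaf).draw c 0 ((node A B leaf).height + 1) =
      A.draw c 0 (node A B leaf).height ∪
      B.draw c A.numLeaves ((node A B leaf).height + 1) ∪
      column ((A.numLeaves + B.numLeaves : ℕ) : ℝ) 0 (node A B leaf).height ∪
      bridge c (node A B leaf).height ((0 + A.rootColumn : ℕ) : ℝ)
        ((A.numLeaves + B.numLeaves : ℕ) : ℝ) := by
    simp only [draw, rootColumn, zero_add, add_zero]
  rw [link_eq_closedDiagram]
  unfold closedDiagram
  rw [e1, e2, ← column_union_reflect ((A.numLeaves + B.numLeaves : ℕ) : ℝ)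
    (Nat.cast_nonneg (node A' B' leaf).height) (Nat.cast_nonneg (node A B leaf).height)]
  simp only [Set.image_union, reflect_bridge, rootColumn, numLeaves, zero_add, ← hA]
  ext p
  simp only [Set.mem_union]
  tauto

/-- A coarse location of the points, for comparing two diagrams: on a drawn tree, on a closing
bridge, or in the closing column. -/
theorem mem_closedDiagram (c : CrossingRule) {T S : TernaryTree}
    (hn : T.numLeaves = S.numLeaves) {k Y Y' X : ℕ} (hY : T.height ≤ Y) (hY' : S.height ≤ Y')
    (hX : k + T.numLeaves ≤ X) {p : Space} (hp : p ∈ closedDiagram c T S k Y Y' X) :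
    ((k : ℝ) ≤ p.1 ∧ p.1 + 1 ≤ k + T.numLeaves ∧
      ((-(S.height : ℝ) ≤ p.2.1 ∧ p.2.1 ≤ T.height) ∨ p.2.2 = 0)) ∨
    ((k : ℝ) ≤ p.1 ∧ p.1 ≤ X ∧ (p.2.1 = Y ∨ p.2.1 = -Y') ∧
      (p.1 + 1 ≤ k + T.numLeaves ∨ p.1 = X ∨ p.2.2 = c.level)) ∨
    (p.1 = X ∧ -(Y' : ℝ) ≤ p.2.1 ∧ p.2.1 ≤ Y) := by
  have cX : (k : ℝ) + T.numLeaves ≤ X := by exact_mod_cast hX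
  have hT0 : (0 : ℝ) ≤ T.height := Nat.cast_nonneg _
  have hS0 : (0 : ℝ) ≤ S.height := Nat.cast_nonneg _
  have key : ∀ r : ℕ, r < T.numLeaves → ∀ y : ℝ,
      p ∈ bridge c y ((k + r : ℕ) : ℝ) X → (k : ℝ) ≤ p.1 ∧ p.1 ≤ X ∧ p.2.1 = y ∧
        (p.1 + 1 ≤ k + T.numLeaves ∨ p.1 = X ∨ p.2.2 = c.level) := by
    rintro r hr y ⟨h1, h2⟩
    have hr' : (r : ℝ) + 1 ≤ T.numLeaves := by exact_mod_cast hr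
    have hr0 : (0 : ℝ) ≤ r := Nat.cast_nonneg _
    push_cast at h2
    rcases h2 with ⟨⟨h2, h3⟩, h4⟩ | ⟨h2 | h2, -⟩
    · exact ⟨by linarith, h3, h1, Or.inr (Or.inr h4)⟩
    · exact ⟨by linarith, by linarith, h1, Or.inl (by linarith)⟩
    · exact ⟨by linarith, h2.le, h1, Or.inr (Or.inl h2)⟩
  rcases hp with (hp | ⟨p, hp, rfl⟩) | ((hp | ⟨h1, h2, -⟩) | hp)
  · obtain ⟨h1, h2, h3, h4, h5⟩ := draw_bounds c T k Y hY p hp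
    exact Or.inl ⟨h1, h2, h5.imp_left fun h => ⟨by linarith, h⟩⟩
  · obtain ⟨h1, h2, h3, h4, h5⟩ := draw_bounds c S k Y' hY' p hp
    rw [← hn] at h2
    exact Or.inl ⟨h1, h2, h5.imp_left fun h => ⟨neg_le_neg h, by simp [reflect]; linarith⟩⟩
  · obtain ⟨h1, h2, h3, h4⟩ := key _ T.rootColumn_lt _ hp
    exact Or.inr (Or.inl ⟨h1, h2, Or.inl h3, h4⟩)
  · exact Or.inr (Or.inr ⟨h1, h2.1, h2.2⟩)
  · obtain ⟨h1, h2, h3, h4⟩ := key _ (hn ▸ S.rootColumn_lt) _ hp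
    exact Or.inr (Or.inl ⟨h1, h2, Or.inr h3, h4⟩)

/-- In the diagram of a pair `(node A B leaf, node A' B' leaf)`, the strands that come from
`(A, A')` run on the same side of those that come from `(B, B')`. -/
theorem closedDiagram_above (c : CrossingRule) {A A' B B' : TernaryTree}
    (hA : A.numLeaves = A'.numLeaves) (hB : B.numLeaves = B'.numLeaves) {h h' : ℕ}
    (hAh : A.height < h) (hBh : B.height < h) (hAh' : A'.height < h') (hBh' : B'.height < h') :
    ∀ a ∈ closedDiagram c A A' 0 h h' (A.numLeaves + B.numLeaves),
    ∀ b ∈ closedDiagram c B B' A.numLeaves (h + 1) (h' + 1) (A.numLeaves + B.numLeaves + 1),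
      a.1 = b.1 → a.2.1 = b.2.1 → 0 < c.level * (a.2.2 - b.2.2) := by
  intro a ha b hb hx hy
  have cA : (A'.height : ℝ) + 1 ≤ h' := by exact_mod_cast hAh'
  have cB : (B.height : ℝ) + 1 ≤ h := by exact_mod_cast hBh
  have cB' : (B'.height : ℝ) + 1 ≤ h' := by exact_mod_cast hBh'
  have h0 : (0 : ℝ) ≤ h := Nat.cast_nonneg _
  have h0' : (0 : ℝ) ≤ h' := Nat.cast_nonneg _
  have nB : (0 : ℝ) ≤ B.numLeaves := Nat.cast_nonneg _
  have ha' := mem_closedDiagram c hA hAh.le hAh'.le (by omega) ha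
  have hb' := mem_closedDiagram c hB (by omega) (by omega) (by omega) hb
  rw [hx, hy] at ha'
  push_cast at ha' hb'
  have fin : a.2.2 = c.level → b.2.2 = 0 → 0 < c.level * (a.2.2 - b.2.2) := by
    intro h1 h2
    rw [h1, h2]
    cases c <;> norm_num [CrossingRule.level]
  -- The trees occupy disjoint ranges of columns, and both closing columns lie to the right of them.
  -- The bridges of the inner arc run at heights `h` and `-h'`, beyond all vertices of `B` and `B'`
  -- but short of the outer bridges. The only overlap left is an inner bridge at level `c.level`
  -- crossing a root edge of `B` or `B'` at level `0`.
  rcases ha' with ⟨-, a2, -⟩ | ⟨-, a2, a3 | a3, a4 | a4 | a4⟩ | ⟨a1, a2, a3⟩ <;>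
  rcases hb' with ⟨b1, b2, ⟨b3, b4⟩ | b3⟩ | ⟨b1, b2, b3 | b3, b4⟩ | ⟨b1, b2, b3⟩ <;>
  first
  | exact fin a4 b3
  | (exfalso; linarith)

end TernaryTree

/-! ### The link of `F3.sqcup` -/

theorem CrossingRule.abs_level (c : CrossingRule) : |c.level| = 1 := by
  cases c <;> simp [CrossingRule.level]

theorem F3.jonesLink_sqcup (c : CrossingRule) {f : F3} (g : F3) (hf : f ≠ 1) :
    jonesLink c (sqcup f g) = IsotopyClass.disjointUnion (jonesLink c f) (jonesLink c g) := by
  have nf := f.reducedPair_spec.1.numLeaves_eq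
  have ng := g.reducedPair_spec.1.numLeaves_eq
  have height : ∀ A B : TernaryTree, A.height < (TernaryTree.node A B .leaf).height ∧
      B.height < (TernaryTree.node A B .leaf).height := by
    intro A B
    simp only [TernaryTree.height]
    omega
  obtain ⟨h1, h2⟩ := height g.reducedPair.1 f.reducedPair.1
  obtain ⟨h1', h2'⟩ := height g.reducedPair.2 f.reducedPair.2
  unfold jonesLink
  rw [reducedPair_sqcup g hf, TernaryTree.link_node_leaf c ng nf,
    mk_union_eq_disjointUnion (TernaryTree.isCompact_closedDiagram _ _ _ _ _ _ _)
      (TernaryTree.isCompact_closedDiagram _ _ _ _ _ _ _)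
      (TernaryTree.closedDiagram_nonempty _ _ _ _ _ _ _)
      (TernaryTree.closedDiagram_nonempty _ _ _ _ _ _ _) c.abs_level
      (TernaryTree.closedDiagram_above c ng nf h1 h2 h1' h2')]
  -- What remains is to undo the stretching: the outer closed diagram is the link of `f`, the inner
  -- one that of `g`.
  congr 1
  · exact Quotient.sound (TernaryTree.isotopic_closedDiagram c nf (h2.trans (Nat.lt_succ_self _))
      (h2'.trans (Nat.lt_succ_self _)) (Nat.le_succ _)).symm
  · exact Quotient.sound (TernaryTree.isotopic_closedDiagram c ng h1 h1' (by omega)).symm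

theorem mainTheorem7 :
    (∀ f g : F3,
      F3.sqcup f g = F3.phi [1] f * F3.phi [0] g ∧
      F3.sqcup f g = F3.phi [0] g * F3.phi [1] f) ∧
    (∀ (c : CrossingRule) (f g : F3), f ≠ 1 → g ≠ 1 →
      F3.jonesLink c (F3.sqcup f g) =
        IsotopyClass.disjointUnion (F3.jonesLink c f) (F3.jonesLink c g)) ∧
    (∀ f f' g g' : F3,
      F3.sqcup (f * f') (g * g') = F3.sqcup f g * F3.sqcup f' g') :=
  ⟨fun _ _ => ⟨rfl, F3.phi_commute (by decide) _ _⟩,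
    fun c _ g hf _ => F3.jonesLink_sqcup c g hf, F3.sqcup_mul⟩
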